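/- **Theorem.** Let $\mathbb H_+$ be the open upper half-plane, let $\Gamma\subset\mathbb H_+$ be a compact simple $C^1$ curve with arc length measure $|d\zeta|$, and let $z\in\mathbb H_+\setminus\Gamma$. For $u\in L^2(\Gamma)=L^2(\Gamma,|d\zeta|)$ (complex valued) put $$(\mathcal K u)(\zeta)=\frac1{2\pi}\int_\Gamma\frac{i\,u(\tau)}{\zeta-\overline\tau}\,|d\tau|,\qquad p_z(\zeta)=\frac{i}{\zeta-\overline z}.$$ Let $H^2$ be the Hardy space of functions $f$ analytic in $\mathbb H_+$ with $\sup_{y>0}\|f(\cdot+iy)\|_{L^2(\mathbb R)}<\infty$, normed by $\|f\|_{H^2}=\|f\|_{L^2(\mathbb R)}$, the norm of the boundary values of $f$. Let $\{e_n\}_{n\ge1}$ be an orthonormal basis of $L^2(\Gamma)$ of eigenfunctions of $\mathcal K$, $\mathcal K e_n=\lambda_ne_n$, and $\pi_n=(p_z,e_n)_{L^2(\Gamma)}$. Assume that, for some constants $C_1,C_2>0$ and $0<\alpha<\beta<2\alpha$, $$\lim_{n\to\infty}\frac{\lambda_n}{C_1e^{-\alpha n}}=1,\qquad \lim_{n\to\infty}\frac{|\pi_n|^2}{C_2e^{-\beta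 n}}=1.$$ Then $\sum_n|\pi_n|^2/\lambda_n<\infty$ and $\sum_n|\pi_n|^2/\lambda_n^2=\infty$ (terms with $\lambda_n=\pi_n=0$ being read as $0$). For every $\epsilon>0$ the equation $\mathcal K u+\epsilon^2u=p_z$ has a unique solution $u=u_{\epsilon,z}\in L^2(\Gamma)$. It extends to a function in $H^2$, again written $u_{\epsilon,z}$, by $u_{\epsilon,z}(\zeta)=\epsilon^{-2}\big(p_z(\zeta)-(\mathcal K u_{\epsilon,z})(\zeta)\big)$. Put $$M_{\epsilon,z}(\zeta)=u_{\epsilon,z}(\zeta)\,\min\left\{\frac1{\|u_{\epsilon,z}\|_{H^2}},\frac{\epsilon}{\|u_{\epsilon,z}\|_{L^2(\Gamma)}}\right\}.$$ Then for every $\epsilon_0>0$ there are constants $c,C>0$, independent of $\epsilon$, such that for all $0<\epsilon\le\epsilon_0$ the number $M_{\epsilon,z}(z)$ is real and $$c\,\epsilon\,\|u_{\epsilon,z}\|_{H^2}\le\|u_{\epsilon,z}\|_{L^2(\Gamma)}\le C\,\epsilon\,\|u_{\epsilon,z}\|_{H^2},\qquad c\,\epsilon^{\frac{\beta-\alpha}{\alpha}}\le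 M_{\epsilon,z}(z)\le C\,\epsilon^{\frac{\beta-\alpha}{\alpha}}.$$ -/

import Mathlib

open MeasureTheory Filter Topology Set
open scoped ENNReal ComplexConjugate

noncomputable section

/-- A simple `C¹` curve in the plane (an arc or a closed curve), given by a regular `C¹`
parametrization on `[0, 1]`; only the values of `toFun` on `[0, 1]` matter. -/
structure SimpleC1Curve where
  toFun : ℝ → ℂ
  contDiffOn : ContDiffOn ℝ 1 toFun (Icc 0 1)
  regular : ∀ t ∈ Icc (0 : ℝ) 1, derivWithin toFun (Icc 0 1) t ≠ 0
  simple : ∀ s ∈ Icc (0 : ℝ) 1, ∀ t ∈ Icc (0 : ℝ) 1, s < t → toFun s = toFun t → s = 0 ∧ t = 1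
  closes_smoothly : toFun 0 = toFun 1 →
    derivWithin toFun (Icc 0 1) 0 = derivWithin toFun (Icc 0 1) 1

namespace SimpleC1Curve

/-- The curve as a set of points. -/
def trace (Γ : SimpleC1Curve) : Set ℂ := Γ.toFun '' Icc 0 1

/-- The arc length measure `|dζ|` of the curve, as a measure on `ℂ` carried by the curve:
`∫ f |dζ| = ∫₀¹ f (Γ t) |Γ' t| dt`. -/
def arcLength (Γ : SimpleC1Curve) : Measure ℂ :=
  Measure.map Γ.toFun
    ((volume.restrict (Icc 0 1)).withDensity fun t => ‖derivWithin Γ.toFun (Icc 0 1) t‖ₑ)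

/-- The Hilbert space `L²(Γ) = L²(Γ, |dζ|)` of complex valued functions. -/
abbrev L2 (Γ : SimpleC1Curve) : Type := Lp ℂ 2 Γ.arcLength

end SimpleC1Curve

/-- `f` belongs to the Hardy space `H²` of the upper half-plane: it is analytic there and
`sup_{y > 0} ‖f(· + iy)‖_{L²(ℝ)} < ∞`. -/
def MemHardy (f : ℂ → ℂ) : Prop :=
  DifferentiableOn ℂ f {ζ | 0 < ζ.im} ∧
    (⨆ (y : ℝ) (_ : 0 < y), eLpNorm (fun x : ℝ => f (x + y * Complex.I)) 2 volume) < ⊤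

/-- The boundary values on `ℝ` of a function on the upper half-plane, as vertical limits
(these exist almost everywhere for members of `H²`). -/
def boundaryValue (f : ℂ → ℂ) (x : ℝ) : ℂ :=
  limUnder (𝓝[>] (0 : ℝ)) fun y => f (x + y * Complex.I)

/-- The norm of `H²`: the `L²(ℝ)` norm of the boundary values. -/
def hardyNorm (f : ℂ → ℂ) : ℝ := (eLpNorm (boundaryValue f) 2 volume).toReal

/-- `(𝒦 u)(ζ) = (1 / 2π) ∫_Γ i u(τ) / (ζ - conj τ) |dτ|`, at every point `ζ` of the plane. -/
def cauchyK (Γ : SimpleC1Curve) (u : Γ.L2) (ζ : ℂ) : ℂ :=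
  1 / (2 * Real.pi) * ∫ τ, Complex.I * u τ / (ζ - conj τ) ∂Γ.arcLength

/-- `p_z(ζ) = i / (ζ - conj z)`. -/
def pKernel (z ζ : ℂ) : ℂ := Complex.I / (ζ - conj z)

/-- `u ∈ L²(Γ)` solves `𝒦 u + ε² u = p_z` in `L²(Γ)`. -/
def IsSolution (Γ : SimpleC1Curve) (z : ℂ) (ε : ℝ) (u : Γ.L2) : Prop :=
  ∀ᵐ ζ ∂Γ.arcLength, cauchyK Γ u ζ + (ε : ℂ) ^ 2 * u ζ = pKernel z ζ

/-- The extension of a solution `u ∈ L²(Γ)` off the curve, read off the integral equation: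
`u(ζ) = (p_z(ζ) - (𝒦 u)(ζ)) / ε²`. -/
def extendOff (Γ : SimpleC1Curve) (z : ℂ) (ε : ℝ) (u : Γ.L2) (ζ : ℂ) : ℂ :=
  (pKernel z ζ - cauchyK Γ u ζ) / (ε : ℂ) ^ 2

/-- `M(ζ) = u(ζ) min {1 / ‖u‖_{H²}, ε / ‖u‖_{L²(Γ)}}`. -/
def maximizer (Γ : SimpleC1Curve) (z : ℂ) (ε : ℝ) (u : Γ.L2) (ζ : ℂ) : ℂ :=
  extendOff Γ z ε u ζ * ((min (1 / hardyNorm (extendOff Γ z ε u)) (ε / ‖u‖) : ℝ) : ℂ)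

/-- The orthonormal basis `e` of `L²(Γ)` consists of eigenfunctions of `𝒦`, with eigenvalues
`lam`. -/
def IsEigenbasis (Γ : SimpleC1Curve) (e : HilbertBasis ℕ ℂ Γ.L2) (lam : ℕ → ℝ) : Prop :=
  ∀ n, ∀ᵐ ζ ∂Γ.arcLength, cauchyK Γ (e n) ζ = (lam n : ℂ) * e n ζ

/-- The coefficient `(p_z, e)_{L²(Γ)} = ∫_Γ p_z(ζ) conj (e(ζ)) |dζ|`. -/
def pCoeff (Γ : SimpleC1Curve) (z : ℂ) (e : Γ.L2) : ℂ :=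
  ∫ ζ, pKernel z ζ * conj (e ζ) ∂Γ.arcLength

end

/-! Let `T` (`lineCauchy`) send `u ∈ L²(Γ)` to the boundary values of `𝒦 u` on `ℝ`. The kernels
reproduce, `∫_ℝ p_v conj p_w = 2π p_v(w)`, so Fubini gives `T*T = 𝒦`
(`inner_lineCauchy_lineCauchy`). Hence the `T e_n` are orthogonal in `L²(ℝ)` with `‖T e_n‖² = λ_n ≥
0`. A `g` orthogonal to all of them has a holomorphic pairing `w ↦ (g, p_w)` that vanishes on `Γ`,
hence everywhere (`kernelPairing_eq_zero`); so `p_z` and the extended solution lie in the closed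
span of the `T e_n`.

Solving mode by mode, `(u, e_n) = π_n / (λ_n + ε²)`, and Parseval turns the three quantities into
series: `‖u‖² = ∑ |π_n|² / (λ_n + ε²)²`, `‖u‖²_{H²} = ∑ |π_n|² / (λ_n (λ_n + ε²)²)`, `2π u(z) = ∑
|π_n|² / (λ_n (λ_n + ε²))`.

With `s = ε²`, each is `∑ |π_n|² / (λ_n^j (λ_n + s)^k)` with `j < β/α < j + k`. The terms decay
geometrically on both sides of the index where `λ_n ≈ s`, so the sum is comparable to `s^(β/α - j -
k)` (`exists_le_of_hasSum`, `exists_ge_of_hasSum`). With `t = ε^(β/α - 2)` this gives `‖u‖ ≍ t`, `ε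
‖u‖_{H²} ≍ t`, `u(z) ≍ t²`, hence `M(z) ≍ ε t = ε^((β-α)/α)`. -/

namespace SimpleC1Curve

/-! ### Arc length measure and uniqueness of holomorphic functions on the curve. -/

variable (Γ : SimpleC1Curve)

lemma continuousOn_toFun : ContinuousOn Γ.toFun (Icc 0 1) := Γ.contDiffOn.continuousOn

lemma continuousOn_speed :
    ContinuousOn (fun t => ‖derivWithin Γ.toFun (Icc 0 1) t‖ₑ) (Icc 0 1) :=
  (Γ.contDiffOn.continuousOn_derivWithin (uniqueDiffOn_Icc zero_lt_one) le_rfl).enorm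

lemma isCompact_trace : IsCompact Γ.trace := isCompact_Icc.image_of_continuousOn Γ.continuousOn_toFun

lemma aemeasurable_toFun :
    AEMeasurable Γ.toFun ((volume.restrict (Icc 0 1)).withDensity
      fun t => ‖derivWithin Γ.toFun (Icc 0 1) t‖ₑ) :=
  (Γ.continuousOn_toFun.aemeasurable measurableSet_Icc).mono_ac
    (withDensity_absolutelyContinuous _ _)

instance isFiniteMeasure_arcLength : IsFiniteMeasure Γ.arcLength := by
  have hc := Γ.contDiffOn.continuousOn_derivWithin (uniqueDiffOn_Icc zero_lt_one) le_rfl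
  have : IsFiniteMeasure ((volume.restrict (Icc 0 1)).withDensity
      fun t => ‖derivWithin Γ.toFun (Icc 0 1) t‖ₑ) :=
    isFiniteMeasure_withDensity (hc.integrableOn_Icc (μ := volume)).2.ne
  unfold arcLength
  infer_instance

/-- The speed never vanishes on `[0, 1]`, so the density has the same null sets as Lebesgue measure
there. -/
lemma ae_arcLength_iff {p : ℂ → Prop} (hp : MeasurableSet {ζ | p ζ}) :
    (∀ᵐ ζ ∂Γ.arcLength, p ζ) ↔ ∀ᵐ t ∂volume.restrict (Icc (0 : ℝ) 1), p (Γ.toFun t) := by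
  rw [arcLength, ae_map_iff Γ.aemeasurable_toFun hp,
    ae_withDensity_iff' (Γ.continuousOn_speed.aemeasurable measurableSet_Icc)]
  constructor
  · intro h
    filter_upwards [h, ae_restrict_mem measurableSet_Icc] with t ht htI
    exact ht (by simpa using Γ.regular t htI)
  · intro h
    filter_upwards [h] with t ht _
    exact ht

lemma ae_mem_trace : ∀ᵐ ζ ∂Γ.arcLength, ζ ∈ Γ.trace := by
  rw [Γ.ae_arcLength_iff (p := (· ∈ Γ.trace)) Γ.isCompact_trace.measurableSet]
  filter_upwards [ae_restrict_mem measurableSet_Icc] with t ht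
  exact mem_image_of_mem _ ht

/-- A function continuous on the curve that vanishes almost everywhere on it vanishes at all
interior points of the parametrization. -/
lemma eq_zero_of_ae_eq_zero {F : ℂ → ℂ} (hF : ContinuousOn F Γ.trace)
    (h : ∀ᵐ ζ ∂Γ.arcLength, F ζ = 0) {t : ℝ} (ht : t ∈ Ioo (0 : ℝ) 1) : F (Γ.toFun t) = 0 := by
  have hclosed : IsClosed (Γ.trace ∩ F ⁻¹' {0}) :=
    hF.preimage_isClosed_of_isClosed Γ.isCompact_trace.isClosed isClosed_singleton
  have h1 : ∀ᵐ ζ ∂Γ.arcLength, ζ ∈ Γ.trace ∩ F ⁻¹' {0} := by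
    filter_upwards [h, Γ.ae_mem_trace] with ζ h1 h2 using ⟨h2, h1⟩
  rw [Γ.ae_arcLength_iff (p := (· ∈ Γ.trace ∩ F ⁻¹' {0})) hclosed.measurableSet] at h1
  have hcont : ContinuousOn (fun t => F (Γ.toFun t)) (Ioo 0 1) :=
    (hF.comp Γ.continuousOn_toFun (mapsTo_image _ _)).mono Ioo_subset_Icc_self
  refine Measure.eqOn_open_of_ae_eq (μ := volume) (g := fun _ => 0) ?_ isOpen_Ioo hcont
    continuousOn_const ht
  filter_upwards [ae_restrict_of_ae_restrict_of_subset Ioo_subset_Icc_self h1] with t ht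
  exact ht.2

/-- A holomorphic function on the upper half-plane that vanishes almost everywhere on the curve
vanishes identically. -/
lemma eq_zero_of_differentiableOn (hΓ : Γ.trace ⊆ {ζ | 0 < ζ.im}) {F : ℂ → ℂ}
    (hF : DifferentiableOn ℂ F {ζ | 0 < ζ.im}) (h : ∀ᵐ ζ ∂Γ.arcLength, F ζ = 0) {w : ℂ}
    (hw : 0 < w.im) : F w = 0 := by
  have hopen : IsOpen {ζ : ℂ | 0 < ζ.im} := isOpen_lt continuous_const Complex.continuous_im
  have hpre : IsPreconnected {ζ : ℂ | 0 < ζ.im} := (convex_halfSpace_im_gt 0).isPreconnected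
  have hhalf : (1 / 2 : ℝ) ∈ Ioo (0 : ℝ) 1 := by norm_num
  refine (hF.analyticOnNhd hopen).eqOn_zero_of_preconnected_of_frequently_eq_zero hpre
    (hΓ (mem_image_of_mem _ (Ioo_subset_Icc_self hhalf))) ?_ hw
  -- Simplicity makes the zero at parameter `1/2` an accumulation point of zeros: a repeated value
  -- would force `1/2 = 0`.
  have htend : Tendsto Γ.toFun (𝓝[>] (1 / 2)) (𝓝[≠] Γ.toFun (1 / 2)) := by
    have hsub : ∀ᶠ t in 𝓝[>] (1 / 2 : ℝ), t ∈ Ioo (1 / 2 : ℝ) 1 :=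
      Ioo_mem_nhdsGT (by norm_num)
    refine tendsto_nhdsWithin_iff.2 ⟨?_, ?_⟩
    · exact ((Γ.continuousOn_toFun.continuousAt (Icc_mem_nhds hhalf.1 hhalf.2)).tendsto).mono_left
        nhdsWithin_le_nhds
    · filter_upwards [hsub] with t ht heq
      have := Γ.simple (1 / 2) ⟨by norm_num, by norm_num⟩ t
        ⟨by linarith [ht.1], ht.2.le⟩ ht.1 heq.symm
      norm_num at this
  refine htend.frequently (Eventually.frequently ?_)
  filter_upwards [Ioo_mem_nhdsGT (show (1 / 2 : ℝ) < 1 by norm_num)] with t ht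
  exact Γ.eq_zero_of_ae_eq_zero (hF.continuousOn.mono hΓ) h ⟨by linarith [ht.1], ht.2⟩

end SimpleC1Curve

/-! ### Cauchy integrals and the kernels `p_w` on the real line. -/

/-- Differentiability of a Cauchy transform away from the support of the measure. -/
lemma differentiableAt_integral_div_sub {X : Type*} [MeasurableSpace X] {ν : Measure X}
    {g q : X → ℂ} (hg : AEStronglyMeasurable g ν) (hq : AEStronglyMeasurable q ν)
    {w : ℂ} {δ : ℝ} (hδ : 0 < δ) (hdist : ∀ᵐ x ∂ν, δ ≤ ‖w - q x‖)
    (hint : Integrable (fun x => g x / (w - q x)) ν) :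
    DifferentiableAt ℂ (fun w => ∫ x, g x / (w - q x) ∂ν) w := by
  -- This dominates the derivative by a multiple of the integrand at `w` itself, so `g` need not be
  -- integrable; on `ℝ` it is only in `L²`.
  have hb : ∀ᵐ x ∂ν, ∀ v ∈ Metric.ball w (δ / 2), ‖w - q x‖ / 2 ≤ ‖v - q x‖ := by
    filter_upwards [hdist] with x hx v hv
    have h1 : ‖w - v‖ < δ / 2 := by rwa [← dist_eq_norm, dist_comm]
    have h2 := norm_add_le (w - v) (v - q x)
    rw [sub_add_sub_cancel] at h2
    linarith
  refine (hasDerivAt_integral_of_dominated_loc_of_deriv_le (𝕜 := ℂ)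
    (F := fun w x => g x / (w - q x)) (F' := fun w x => -g x / (w - q x) ^ 2)
    (bound := fun x => 4 / δ * ‖g x / (w - q x)‖)
    (Metric.ball_mem_nhds w (half_pos hδ)) ?_ hint ?_ ?_ (hint.norm.const_mul _) ?_).2.differentiableAt
  · exact Eventually.of_forall fun v =>
      hg.div₀ (aestronglyMeasurable_const.sub hq)
  · exact hg.neg.div₀ ((aestronglyMeasurable_const.sub hq).pow 2)
  · filter_upwards [hb, hdist] with x hx hd v hv
    have h1 := hx v hv
    have hpos : 0 < ‖w - q x‖ := hδ.trans_le hd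
    rw [norm_div, norm_neg, norm_pow, norm_div]
    calc ‖g x‖ / ‖v - q x‖ ^ 2 ≤ ‖g x‖ / (‖w - q x‖ / 2) ^ 2 := by gcongr
      _ = 4 * (‖w - q x‖)⁻¹ * (‖g x‖ / ‖w - q x‖) := by field_simp; norm_num
      _ ≤ 4 * δ⁻¹ * (‖g x‖ / ‖w - q x‖) := by gcongr
      _ = _ := by rw [div_eq_mul_inv 4 δ]
  · filter_upwards [hb, hdist] with x hx hd v hv
    have h1 := hx v hv
    have hpos : 0 < ‖v - q x‖ := lt_of_lt_of_le (half_pos (hδ.trans_le hd)) h1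
    have hne : v - q x ≠ 0 := norm_pos_iff.1 hpos
    have := (hasDerivAt_const v (g x)).fun_div ((hasDerivAt_id v).sub_const (q x)) hne
    simpa using this

/-- A square integrable majorant, up to constants, of the kernels `p_w` on horizontal lines. -/
noncomputable def lineWeight (x : ℝ) : ℝ := (√(1 + x ^ 2))⁻¹

lemma memLp_lineWeight : MemLp lineWeight 2 volume := by
  have hc : Continuous lineWeight := by
    unfold lineWeight
    exact (by fun_prop : Continuous fun x : ℝ => √(1 + x ^ 2)).inv₀ fun x => by positivity
  rw [memLp_two_iff_integrable_sq hc.aestronglyMeasurable]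
  refine integrable_inv_one_add_sq.congr (Eventually.of_forall fun x => ?_)
  simp only [lineWeight]
  rw [inv_pow, Real.sq_sqrt (by positivity)]

lemma exists_norm_pKernel_le {S : Set ℂ} (hS : IsCompact S) (hpos : S ⊆ {ζ | 0 < ζ.im}) :
    ∃ C : ℝ, 0 < C ∧ ∀ τ ∈ S, ∀ ζ : ℂ, 0 ≤ ζ.im → ‖pKernel τ ζ‖ ≤ C * lineWeight ζ.re := by
  obtain ⟨δ, hδ, hδS⟩ := hS.exists_forall_le' Complex.continuous_im.continuousOn
    (fun b hb => hpos hb)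
  obtain ⟨A, hA⟩ := hS.isBounded.exists_norm_le
  -- From `1 + x² ≤ 2 (x - Re τ)² + 1 + 2A²`, the constant part being absorbed through `δ ≤ |ζ -
  -- conj τ|`.
  refine ⟨√(2 + (1 + 2 * A ^ 2) / δ ^ 2), by positivity, fun τ hτ ζ hζ => ?_⟩
  have h1 := hδS τ hτ
  have h2 : |τ.re| ≤ A := (Complex.abs_re_le_norm τ).trans (hA τ hτ)
  have h3 : τ.re ^ 2 ≤ A ^ 2 := sq_le_sq' (by linarith [neg_abs_le τ.re]) ((le_abs_self _).trans h2)
  have hsq : ‖ζ - conj τ‖ ^ 2 = (ζ.re - τ.re) ^ 2 + (ζ.im + τ.im) ^ 2 := by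
    rw [← Complex.normSq_eq_norm_sq, Complex.normSq_apply]; simp; ring
  have hlow : δ ^ 2 ≤ (ζ.im + τ.im) ^ 2 := by
    have : δ ≤ ζ.im + τ.im := by linarith
    gcongr
  have hpos' : 0 < ‖ζ - conj τ‖ := by
    have : 0 < ‖ζ - conj τ‖ ^ 2 := by rw [hsq]; nlinarith [sq_nonneg (ζ.re - τ.re), sq_pos_of_pos hδ]
    exact norm_pos_iff.2 fun h => by simp [h] at this
  have hmain : 1 + ζ.re ^ 2 ≤ (2 + (1 + 2 * A ^ 2) / δ ^ 2) * ‖ζ - conj τ‖ ^ 2 := by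
    have e1 : (1 + 2 * A ^ 2) ≤ (1 + 2 * A ^ 2) / δ ^ 2 * ‖ζ - conj τ‖ ^ 2 := by
      rw [div_mul_eq_mul_div, le_div_iff₀ (by positivity), hsq]
      gcongr
      nlinarith [sq_nonneg (ζ.re - τ.re)]
    rw [add_mul]
    have e2 : 1 + ζ.re ^ 2 ≤ 2 * (ζ.re - τ.re) ^ 2 + (1 + 2 * A ^ 2) := by
      nlinarith [sq_nonneg (ζ.re - 2 * τ.re)]
    have e3 : (ζ.re - τ.re) ^ 2 ≤ ‖ζ - conj τ‖ ^ 2 := by rw [hsq]; nlinarith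
    linarith
  have := Real.sqrt_le_sqrt hmain
  rw [Real.sqrt_mul (by positivity), Real.sqrt_sq hpos'.le] at this
  rw [pKernel, norm_div, Complex.norm_I, lineWeight, ← div_eq_mul_inv,
    div_le_div_iff₀ hpos' (by positivity), one_mul]
  exact this

lemma sub_conj_ne_zero {τ ζ : ℂ} (hτ : 0 < τ.im) (hζ : 0 ≤ ζ.im) : ζ - conj τ ≠ 0 := by
  intro h
  have := congrArg Complex.im h
  simp at this
  linarith

lemma conj_pKernel (τ ζ : ℂ) : conj (pKernel τ ζ) = pKernel ζ τ := by
  rw [pKernel, pKernel, map_div₀, Complex.conj_I, map_sub, Complex.conj_conj, ← neg_sub τ,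
    neg_div_neg_eq]

lemma differentiableAt_pKernel {τ ζ : ℂ} (hτ : 0 < τ.im) (hζ : 0 ≤ ζ.im) :
    DifferentiableAt ℂ (pKernel τ) ζ := by
  unfold pKernel
  exact (differentiableAt_const _).div (by fun_prop) (sub_conj_ne_zero hτ hζ)

/-- The two `log x` terms cancel, leaving `log i - log (-i)`. The factors `±i` keep both arguments
in the right half-plane when `a` lies above and `b` below the real axis, so the principal branch can
serve as a primitive. -/
lemma tendsto_log_sub_log_atTop (a b : ℂ) :
    Tendsto (fun x : ℝ => Complex.log (Complex.I * (x - a)) - Complex.log (-Complex.I * (x - b)))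
      atTop (𝓝 (Real.pi * Complex.I)) := by
  have hinv (a : ℂ) : Tendsto (fun x : ℝ => 1 - a * ((x⁻¹ : ℝ) : ℂ)) atTop (𝓝 1) := by
    have h := (Complex.continuous_ofReal.tendsto 0).comp tendsto_inv_atTop_zero
    simpa using tendsto_const_nhds.sub (h.const_mul a)
  have hslit (k : ℂ) (hk : k ∈ Complex.slitPlane) (a : ℂ) :
      Tendsto (fun x : ℝ => Complex.log (k * (1 - a * ((x⁻¹ : ℝ) : ℂ)))) atTop
        (𝓝 (Complex.log k)) := by
    have h := (hinv a).const_mul k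
    rw [mul_one] at h
    exact h.clog hk
  have hne (a : ℂ) : ∀ᶠ x : ℝ in atTop, (1 - a * ((x⁻¹ : ℝ) : ℂ)) ≠ 0 :=
    (hinv a).eventually_ne one_ne_zero
  have hlim := (hslit Complex.I (by simp [Complex.mem_slitPlane_iff]) a).sub
    (hslit (-Complex.I) (by simp [Complex.mem_slitPlane_iff]) b)
  have hval : Complex.log Complex.I - Complex.log (-Complex.I) = Real.pi * Complex.I := by
    rw [Complex.log_I, Complex.log_neg_I]; ring
  rw [hval] at hlim
  refine hlim.congr' ?_
  filter_upwards [hne a, hne b, eventually_gt_atTop 0] with x ha hb hx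
  have hxc : (x : ℂ) ≠ 0 := by exact_mod_cast hx.ne'
  have e (k a : ℂ) : k * (x - a) = x * (k * (1 - a * ((x⁻¹ : ℝ) : ℂ))) := by
    push_cast; field_simp
  rw [e, e, Complex.log_ofReal_mul hx (mul_ne_zero Complex.I_ne_zero ha),
    Complex.log_ofReal_mul hx (mul_ne_zero (neg_ne_zero.2 Complex.I_ne_zero) hb)]
  ring

lemma tendsto_log_sub_log_atBot (a b : ℂ) :
    Tendsto (fun x : ℝ => Complex.log (Complex.I * (x - a)) - Complex.log (-Complex.I * (x - b)))
      atBot (𝓝 (-(Real.pi * Complex.I))) := by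
  have h := ((tendsto_log_sub_log_atTop (-b) (-a)).comp tendsto_neg_atBot_atTop).neg
  refine h.congr fun x => ?_
  simp only [Function.comp_apply, Complex.ofReal_neg, neg_sub]
  congr 2 <;> ring

lemma memLp_pKernel {w : ℂ} (hw : 0 < w.im) : MemLp (fun x : ℝ => pKernel w x) 2 volume := by
  obtain ⟨C, -, hC⟩ := exists_norm_pKernel_le (isCompact_singleton (x := w))
    (by simpa using hw)
  have hc : Continuous fun x : ℝ => pKernel w x := by
    refine continuous_iff_continuousAt.2 fun x => ?_
    exact (differentiableAt_pKernel hw (by simp)).continuousAt.comp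
      Complex.continuous_ofReal.continuousAt
  refine (memLp_lineWeight.const_mul C).mono hc.aestronglyMeasurable (Eventually.of_forall fun x => ?_)
  exact (hC w rfl x (by simp)).trans (le_abs_self _)

/-- Reproducing property of the kernels: `∫_ℝ p_v conj p_w = 2π p_v(w)`. -/
lemma integral_conj_pKernel_mul {v w : ℂ} (hv : 0 < v.im) (hw : 0 < w.im) :
    ∫ x : ℝ, conj (pKernel w x) * pKernel v x = 2 * Real.pi * pKernel v w := by
  have hwv : w - conj v ≠ 0 := sub_conj_ne_zero hv hw.le
  have hint : Integrable (fun x : ℝ => conj (pKernel w x) * pKernel v x) :=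
    (memLp_pKernel hw).star.integrable_mul (memLp_pKernel hv)
  -- Partial fractions of `1 / ((x - w) (x - conj v))`.
  have hderiv : ∀ x : ℝ, HasDerivAt (fun x : ℝ => (Complex.log (Complex.I * (x - w)) -
      Complex.log (-Complex.I * (x - conj v))) / (w - conj v))
      (conj (pKernel w x) * pKernel v x) x := by
    intro x
    have h0 (k a : ℂ) : HasDerivAt (fun x : ℝ => k * ((x : ℂ) - a)) (k * 1) x :=
      ((HasDerivAt.ofReal_comp (hasDerivAt_id x)).sub_const a).const_mul k
    have h1 := (h0 Complex.I w).clog_real (Or.inl (by simpa using hw))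
    have h2 := (h0 (-Complex.I) (conj v)).clog_real (Or.inl (by simpa using hv))
    refine ((h1.sub h2).div_const (w - conj v)).congr_deriv ?_
    have e1 : (x : ℂ) - w ≠ 0 := fun h => by
      have := congrArg Complex.im h
      simp at this
      exact hw.ne' this
    have e2 : w - (x : ℂ) ≠ 0 := fun h => e1 (by rw [← neg_sub, h, neg_zero])
    have e3 : (x : ℂ) - conj v ≠ 0 := sub_conj_ne_zero hv (by simp)
    rw [conj_pKernel, pKernel, pKernel, Complex.conj_ofReal]
    have hI := Complex.I_ne_zero
    field_simp
    rw [Complex.I_sq]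
    ring
  rw [integral_of_hasDerivAt_of_tendsto hderiv hint
    ((tendsto_log_sub_log_atBot _ _).div_const _) ((tendsto_log_sub_log_atTop _ _).div_const _),
    pKernel]
  ring

/-! ### Regularity and decay of `𝒦 u` on the closed half-plane. -/

namespace SimpleC1Curve

variable (Γ : SimpleC1Curve)

lemma memLp_of_continuousOn {F : ℂ → ℂ} (hF : ContinuousOn F Γ.trace) :
    MemLp F 2 Γ.arcLength := by
  obtain ⟨C, hC⟩ := Γ.isCompact_trace.exists_bound_of_continuousOn hF
  have hm : AEStronglyMeasurable F Γ.arcLength := by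
    rw [← Measure.restrict_eq_self_of_ae_mem Γ.ae_mem_trace]
    exact hF.aestronglyMeasurable Γ.isCompact_trace.measurableSet
  exact MemLp.of_bound hm C (Γ.ae_mem_trace.mono hC)

lemma integrable_L2 (u : Γ.L2) : Integrable u Γ.arcLength := (Lp.memLp u).integrable one_le_two

end SimpleC1Curve

section Cauchy

variable (Γ : SimpleC1Curve)

lemma cauchyK_eq (u : Γ.L2) (ζ : ℂ) :
    cauchyK Γ u ζ = 1 / (2 * Real.pi) * ∫ τ, u τ * pKernel τ ζ ∂Γ.arcLength := by
  simp only [cauchyK, pKernel]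
  congr 2 with τ
  ring

lemma measurable_pKernel_left (ζ : ℂ) : Measurable fun τ => pKernel τ ζ := by
  unfold pKernel
  exact measurable_const.div (measurable_const.sub Complex.continuous_conj.measurable)

variable {Γ}

lemma exists_norm_mul_pKernel_le (hΓ : Γ.trace ⊆ {ζ | 0 < ζ.im}) (u : Γ.L2) :
    ∃ C : ℝ, 0 < C ∧ ∀ ζ : ℂ, 0 ≤ ζ.im → ∀ᵐ τ ∂Γ.arcLength,
      ‖u τ * pKernel τ ζ‖ ≤ ‖u τ‖ * (C * lineWeight ζ.re) := by
  obtain ⟨C, hC, h⟩ := exists_norm_pKernel_le Γ.isCompact_trace hΓ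
  refine ⟨C, hC, fun ζ hζ => ?_⟩
  filter_upwards [Γ.ae_mem_trace] with τ hτ
  rw [norm_mul]
  gcongr
  exact h τ hτ ζ hζ

lemma integrable_mul_pKernel (hΓ : Γ.trace ⊆ {ζ | 0 < ζ.im}) (u : Γ.L2) {ζ : ℂ}
    (hζ : 0 ≤ ζ.im) : Integrable (fun τ => u τ * pKernel τ ζ) Γ.arcLength := by
  obtain ⟨C, -, h⟩ := exists_norm_mul_pKernel_le hΓ u
  refine ((Γ.integrable_L2 u).norm.mul_const (C * lineWeight ζ.re)).mono'
    ((Lp.aestronglyMeasurable u).mul (measurable_pKernel_left ζ).aestronglyMeasurable) (h ζ hζ)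

lemma exists_norm_cauchyK_le (hΓ : Γ.trace ⊆ {ζ | 0 < ζ.im}) (u : Γ.L2) :
    ∃ C : ℝ, 0 ≤ C ∧ ∀ ζ : ℂ, 0 ≤ ζ.im → ‖cauchyK Γ u ζ‖ ≤ C * lineWeight ζ.re := by
  obtain ⟨C, hC, h⟩ := exists_norm_mul_pKernel_le hΓ u
  refine ⟨‖(1 / (2 * Real.pi) : ℂ)‖ * ((∫ τ, ‖u τ‖ ∂Γ.arcLength) * C),
    by positivity, fun ζ hζ => ?_⟩
  rw [cauchyK_eq, norm_mul, mul_assoc, mul_assoc]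
  gcongr
  rw [← integral_mul_const]
  exact norm_integral_le_of_norm_le ((Γ.integrable_L2 u).norm.mul_const _) (h ζ hζ)

lemma differentiableAt_cauchyK (hΓ : Γ.trace ⊆ {ζ | 0 < ζ.im}) (u : Γ.L2) {ζ : ℂ}
    (hζ : 0 ≤ ζ.im) : DifferentiableAt ℂ (cauchyK Γ u) ζ := by
  obtain ⟨δ, hδ, hδS⟩ := Γ.isCompact_trace.exists_forall_le' Complex.continuous_im.continuousOn
    (fun b hb => hΓ hb)
  unfold cauchyK
  refine (differentiableAt_integral_div_sub (g := fun τ => Complex.I * u τ)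
    (q := fun τ => conj τ) ((Lp.aestronglyMeasurable u).const_mul _)
    Complex.continuous_conj.aestronglyMeasurable hδ ?_ ?_).const_mul _
  · filter_upwards [Γ.ae_mem_trace] with τ hτ
    refine le_trans ?_ (Complex.abs_im_le_norm _)
    have := hδS τ hτ
    refine le_trans ?_ (le_abs_self _)
    simp
    linarith
  · refine (integrable_mul_pKernel hΓ u hζ).congr (Eventually.of_forall fun τ => ?_)
    simp only [pKernel]
    ring

lemma continuous_cauchyK_ofReal (hΓ : Γ.trace ⊆ {ζ | 0 < ζ.im}) (u : Γ.L2) :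
    Continuous fun x : ℝ => cauchyK Γ u x :=
  continuous_iff_continuousAt.2 fun x =>
    ContinuousAt.comp (f := fun x : ℝ => (x : ℂ))
      (differentiableAt_cauchyK hΓ u (ζ := (x : ℂ)) (by simp)).continuousAt
      Complex.continuous_ofReal.continuousAt

lemma memLp_cauchyK_ofReal (hΓ : Γ.trace ⊆ {ζ | 0 < ζ.im}) (u : Γ.L2) :
    MemLp (fun x : ℝ => cauchyK Γ u x) 2 volume := by
  obtain ⟨C, -, hC⟩ := exists_norm_cauchyK_le hΓ u
  refine (memLp_lineWeight.const_mul C).mono (continuous_cauchyK_ofReal hΓ u).aestronglyMeasurable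
    (Eventually.of_forall fun x => ?_)
  exact (hC x (by simp)).trans (le_abs_self _)

lemma memLp_cauchyK (hΓ : Γ.trace ⊆ {ζ | 0 < ζ.im}) (u : Γ.L2) :
    MemLp (cauchyK Γ u) 2 Γ.arcLength :=
  Γ.memLp_of_continuousOn fun _ hζ =>
    (differentiableAt_cauchyK hΓ u (hΓ hζ).le).continuousAt.continuousWithinAt

lemma memLp_pKernel_arcLength (hΓ : Γ.trace ⊆ {ζ | 0 < ζ.im}) {z : ℂ} (hz : 0 < z.im) :
    MemLp (pKernel z) 2 Γ.arcLength :=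
  Γ.memLp_of_continuousOn fun _ hζ =>
    (differentiableAt_pKernel hz (hΓ hζ).le).continuousAt.continuousWithinAt

end Cauchy

/-! ### Passing between `L²(Γ)` and `L²(ℝ)`. -/

/-- The pairing `w ↦ ∫_ℝ g conj p_w`, which reproduces `2π g(w)` for `g` in the Hardy space. -/
noncomputable def kernelPairing (g : ℝ → ℂ) (w : ℂ) : ℂ := ∫ x : ℝ, conj (pKernel w x) * g x

lemma kernelPairing_eq (g : ℝ → ℂ) (w : ℂ) :
    kernelPairing g w = ∫ x : ℝ, Complex.I * g x / (w - x) := by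
  unfold kernelPairing
  congr 1 with x
  rw [conj_pKernel, pKernel, Complex.conj_ofReal]
  ring

lemma differentiableOn_kernelPairing {g : ℝ → ℂ} (hg : MemLp g 2 volume) :
    DifferentiableOn ℂ (kernelPairing g) {ζ | 0 < ζ.im} := by
  intro w hw
  refine DifferentiableAt.differentiableWithinAt ?_
  rw [show kernelPairing g = fun w => ∫ x : ℝ, Complex.I * g x / (w - x) from
    funext (kernelPairing_eq g)]
  refine differentiableAt_integral_div_sub (g := fun x => Complex.I * g x)
    (hg.aestronglyMeasurable.const_mul _) Complex.continuous_ofReal.aestronglyMeasurable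
    (δ := w.im) hw (Eventually.of_forall fun x => ?_) ?_
  · refine le_trans ?_ (Complex.abs_im_le_norm _)
    simpa using le_abs_self w.im
  · have h : Integrable (fun x : ℝ => conj (pKernel w x) * g x) :=
      (memLp_pKernel hw).star.integrable_mul hg
    refine h.congr (Eventually.of_forall fun x => ?_)
    change conj (pKernel w x) * g x = Complex.I * g x / (w - x)
    rw [conj_pKernel, pKernel, Complex.conj_ofReal]
    ring

section Fubini

variable {Γ : SimpleC1Curve}

/-- This identifies the adjoint of `T`: it takes `g` to `(2π)⁻¹` times its kernel pairing,
restricted to `Γ`. Fubini applies because the uniform kernel bound gives a product majorant. -/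
lemma integral_conj_cauchyK_mul (hΓ : Γ.trace ⊆ {ζ | 0 < ζ.im}) (u : Γ.L2) {g : ℝ → ℂ} (hg : MemLp g 2 volume) :
    ∫ x : ℝ, conj (cauchyK Γ u x) * g x =
      1 / (2 * Real.pi) * ∫ τ, conj (u τ) * kernelPairing g τ ∂Γ.arcLength := by
  obtain ⟨C, hC, hb⟩ := exists_norm_pKernel_le Γ.isCompact_trace hΓ
  have hint : Integrable (Function.uncurry fun (x : ℝ) (τ : ℂ) =>
      conj (u τ) * (conj (pKernel τ x) * g x)) (volume.prod Γ.arcLength) := by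
    have hdom : Integrable (fun p : ℝ × ℂ => (C * lineWeight p.1 * ‖g p.1‖) * ‖u p.2‖)
        (volume.prod Γ.arcLength) := by
      refine Integrable.mul_prod (f := fun x => C * lineWeight x * ‖g x‖) (g := fun τ => ‖u τ‖)
        ?_ (Γ.integrable_L2 u).norm
      exact (memLp_lineWeight.const_mul C).integrable_mul hg.norm
    refine hdom.mono' ?_ ?_
    · have h1 : Measurable fun p : ℝ × ℂ => conj (pKernel p.2 p.1) := by
        simp only [pKernel]
        have : Measurable (fun ζ : ℂ => conj ζ) := Complex.continuous_conj.measurable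
        fun_prop
      have h2 : AEStronglyMeasurable (fun p : ℝ × ℂ => conj (u p.2)) (volume.prod Γ.arcLength) :=
        Complex.continuous_conj.comp_aestronglyMeasurable (Lp.aestronglyMeasurable u).comp_snd
      exact h2.mul (h1.aestronglyMeasurable.mul hg.aestronglyMeasurable.comp_fst)
    · have : ∀ᵐ p : ℝ × ℂ ∂volume.prod Γ.arcLength, p.2 ∈ Γ.trace :=
        Measure.quasiMeasurePreserving_snd.ae Γ.ae_mem_trace
      filter_upwards [this] with p hp
      simp only [Function.uncurry, norm_mul, RCLike.norm_conj]
      have h := hb p.2 hp p.1 (by simp)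
      simp only [Complex.ofReal_re] at h
      rw [mul_comm ‖u p.2‖]
      gcongr
  have hswap := integral_integral_swap hint
  simp only [integral_const_mul] at hswap
  change _ = ∫ τ, conj (u τ) * kernelPairing g τ ∂Γ.arcLength at hswap
  rw [← hswap, ← integral_const_mul]
  congr 1 with x
  rw [cauchyK_eq, map_mul, ← integral_conj, mul_assoc, ← integral_mul_const,
    ← integral_const_mul, ← integral_const_mul]
  congr 1 with τ
  simp only [map_mul, map_div₀, map_one, map_ofNat, Complex.conj_ofReal]
  ring

variable (hΓ : Γ.trace ⊆ {ζ | 0 < ζ.im})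

/-- The boundary values on `ℝ` of `𝒦 u`. -/
noncomputable def lineCauchy (u : Γ.L2) :
    Lp ℂ 2 (volume : Measure ℝ) :=
  (memLp_cauchyK_ofReal hΓ u).toLp

/-- The boundary values on `ℝ` of `p_z`. -/
noncomputable def lineKernel {z : ℂ} (hz : 0 < z.im) : Lp ℂ 2 (volume : Measure ℝ) :=
  (memLp_pKernel hz).toLp

lemma inner_lineCauchy (u : Γ.L2) (g : Lp ℂ 2 (volume : Measure ℝ)) :
    inner ℂ (lineCauchy hΓ u) g =
      1 / (2 * Real.pi) * ∫ τ, conj (u τ) * kernelPairing g τ ∂Γ.arcLength := by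
  rw [← integral_conj_cauchyK_mul hΓ u (Lp.memLp g), L2.inner_def]
  refine integral_congr_ae ?_
  filter_upwards [(memLp_cauchyK_ofReal hΓ u).coeFn_toLp] with x hx
  rw [RCLike.inner_apply', lineCauchy, hx]

lemma inner_lineKernel {w : ℂ} (hw : 0 < w.im) (g : Lp ℂ 2 (volume : Measure ℝ)) :
    inner ℂ (lineKernel hw) g = kernelPairing g w := by
  rw [L2.inner_def, kernelPairing]
  refine integral_congr_ae ?_
  filter_upwards [(memLp_pKernel hw).coeFn_toLp] with x hx
  rw [RCLike.inner_apply', lineKernel, hx]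

lemma kernelPairing_lineKernel {v w : ℂ} (hv : 0 < v.im) (hw : 0 < w.im) :
    kernelPairing (lineKernel hv) w = 2 * Real.pi * pKernel v w := by
  rw [← integral_conj_pKernel_mul hv hw, kernelPairing]
  refine integral_congr_ae ?_
  filter_upwards [(memLp_pKernel hv).coeFn_toLp] with x hx
  rw [lineKernel, hx]

lemma inner_lineCauchy_lineKernel (u : Γ.L2) {v : ℂ} (hv : 0 < v.im) :
    inner ℂ (lineCauchy hΓ u) (lineKernel hv) =
      ∫ τ, conj (u τ) * pKernel v τ ∂Γ.arcLength := by
  rw [inner_lineCauchy, ← integral_const_mul]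
  refine integral_congr_ae ?_
  filter_upwards [Γ.ae_mem_trace] with τ hτ
  rw [kernelPairing_lineKernel hv (hΓ hτ)]
  have : (Real.pi : ℂ) ≠ 0 := by exact_mod_cast Real.pi_ne_zero
  field_simp

lemma inner_lineCauchy_lineKernel_eq_pCoeff (u : Γ.L2) {v : ℂ} (hv : 0 < v.im) :
    inner ℂ (lineCauchy hΓ u) (lineKernel hv) = pCoeff Γ v u := by
  rw [inner_lineCauchy_lineKernel, pCoeff]
  simp only [mul_comm]

lemma kernelPairing_lineCauchy (u : Γ.L2) {w : ℂ} (hw : 0 < w.im) :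
    kernelPairing (lineCauchy hΓ u) w = 2 * Real.pi * cauchyK Γ u w := by
  rw [← inner_lineKernel hw, ← inner_conj_symm, inner_lineCauchy_lineKernel, ← integral_conj,
    cauchyK_eq]
  have : (Real.pi : ℂ) ≠ 0 := by exact_mod_cast Real.pi_ne_zero
  field_simp
  simp only [map_mul, Complex.conj_conj, conj_pKernel]

/-- The factorization `T*T = 𝒦`, obtained by reproducing `𝒦 v` on `Γ` from its boundary values. -/
lemma inner_lineCauchy_lineCauchy (u v : Γ.L2) :
    inner ℂ (lineCauchy hΓ u) (lineCauchy hΓ v) =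
      ∫ τ, conj (u τ) * cauchyK Γ v τ ∂Γ.arcLength := by
  rw [inner_lineCauchy, ← integral_const_mul]
  refine integral_congr_ae ?_
  filter_upwards [Γ.ae_mem_trace] with τ hτ
  rw [kernelPairing_lineCauchy hΓ v (hΓ hτ)]
  have : (Real.pi : ℂ) ≠ 0 := by exact_mod_cast Real.pi_ne_zero
  field_simp

end Fubini

/-! ### Parseval's identity and the spectral form of the equation. -/

/-- Parseval's identity for an orthogonal sequence, some of whose members may vanish, and a vector
`f` in its closed span. -/
lemma hasSum_inner_mul_inner_div {H : Type*} [NormedAddCommGroup H] [InnerProductSpace ℂ H]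
    [CompleteSpace H] {T : ℕ → H} {lam : ℕ → ℝ}
    (hT : ∀ m n, inner ℂ (T m) (T n) = if m = n then (lam n : ℂ) else 0) {f : H}
    (hf : ∀ v, (∀ n, inner ℂ (T n) v = 0) → inner ℂ f v = 0) (g : H) :
    HasSum (fun n => inner ℂ f (T n) * inner ℂ (T n) g / lam n) (inner ℂ f g) := by
  have hnorm : ∀ n, lam n = ‖T n‖ ^ 2 := fun n => by
    have h := congrArg Complex.re (hT n n)
    rw [if_pos rfl] at h
    exact h.symm.trans (inner_self_eq_norm_sq (𝕜 := ℂ) (T n))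
  have hnn : ∀ n, 0 ≤ lam n := fun n => by rw [hnorm]; positivity
  let S : Set ℕ := {n | lam n ≠ 0}
  -- Only nonzero members are normalized; the other terms of the series vanish because division by
  -- zero gives zero.
  let h : S → H := fun n => (((√(lam n))⁻¹ : ℝ) : ℂ) • T n
  have hsq : ∀ n : S, ((√(lam n) : ℝ) : ℂ) * (√(lam n) : ℝ) = lam n := fun n => by
    rw [← Complex.ofReal_mul, Real.mul_self_sqrt (hnn n)]
  have hsq0 : ∀ n : S, ((√(lam n) : ℝ) : ℂ) ≠ 0 := fun n => by
    exact_mod_cast (Real.sqrt_pos.2 ((hnn n).lt_of_ne' n.2)).ne'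
  have horth : Orthonormal ℂ h := by
    rw [orthonormal_iff_ite]
    intro m n
    simp only [h, inner_smul_left, inner_smul_right, hT, Complex.conj_ofReal, Subtype.ext_iff]
    split_ifs with hmn
    · have : m = n := Subtype.ext hmn
      subst this
      have := hsq0 m
      rw [← hsq m]
      push_cast
      field_simp
    · simp
  -- The vectors added to complete the basis are orthogonal to every `T n`, hence to `f` by `hf`,
  -- and contribute nothing.
  obtain ⟨w, b, hw, hb⟩ := horth.toSubtypeRange.exists_hilbertBasis_extension
  have hbi : ∀ i : w, b i = (i : H) := fun i => congrFun hb i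
  let j : S → w := fun n => ⟨h n, hw ⟨n, rfl⟩⟩
  have hj : Function.Injective j := fun m n hmn =>
    horth.linearIndependent.injective (congrArg Subtype.val hmn)
  have hsum := b.hasSum_inner_mul_inner f g
  rw [← hj.hasSum_iff] at hsum
  · rw [← hasSum_subtype_iff_of_support_subset (s := S)]
    · refine hsum.congr_fun fun n => ?_
      simp only [Function.comp_apply, hbi, j, h, inner_smul_left, inner_smul_right,
        Complex.conj_ofReal]
      have := hsq0 n
      rw [← hsq n]
      push_cast
      field_simp
    · intro n hn h0
      apply hn
      simp only [h0]
      simp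
  · intro i hi
    have h0 : inner ℂ f (b i) = 0 := by
      refine hf _ fun n => ?_
      by_cases hn : lam n = 0
      · have : T n = 0 := by
          rw [hnorm] at hn
          simpa using hn
        rw [this, inner_zero_left]
      · have hne : j ⟨n, hn⟩ ≠ i := fun h => hi ⟨_, h⟩
        have := b.orthonormal.2 hne
        simp only [hbi, j, h, inner_smul_left, mul_eq_zero] at this
        rw [hbi]
        refine this.resolve_left ?_
        simpa using hsq0 ⟨n, hn⟩
    rw [h0, zero_mul]

section Eigen

variable {Γ : SimpleC1Curve} (hΓ : Γ.trace ⊆ {ζ | 0 < ζ.im})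
  {e : HilbertBasis ℕ ℂ Γ.L2} {lam : ℕ → ℝ}

lemma inner_lineCauchy_eigenfunction (he : IsEigenbasis Γ e lam) (u : Γ.L2) (n : ℕ) :
    inner ℂ (lineCauchy hΓ u) (lineCauchy hΓ (e n)) = lam n * inner ℂ u (e n) := by
  rw [inner_lineCauchy_lineCauchy, L2.inner_def, ← integral_const_mul]
  refine integral_congr_ae ?_
  filter_upwards [he n] with τ hτ
  rw [hτ, RCLike.inner_apply']
  ring

lemma inner_eigenfunction_lineCauchy (he : IsEigenbasis Γ e lam) (u : Γ.L2) (n : ℕ) :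
    inner ℂ (lineCauchy hΓ (e n)) (lineCauchy hΓ u) = lam n * inner ℂ (e n) u := by
  rw [← inner_conj_symm, inner_lineCauchy_eigenfunction hΓ he, map_mul, Complex.conj_ofReal,
    inner_conj_symm]

lemma inner_lineCauchy_eigenbasis (he : IsEigenbasis Γ e lam) (m n : ℕ) :
    inner ℂ (lineCauchy hΓ (e m)) (lineCauchy hΓ (e n)) = if m = n then (lam n : ℂ) else 0 := by
  rw [inner_lineCauchy_eigenfunction hΓ he, orthonormal_iff_ite.1 e.orthonormal]
  simp

include hΓ in
lemma eigenvalue_nonneg (he : IsEigenbasis Γ e lam) (n : ℕ) : 0 ≤ lam n := by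
  have h := congrArg Complex.re (inner_lineCauchy_eigenbasis hΓ he n n)
  rw [if_pos rfl] at h
  rw [show lam n = ‖lineCauchy hΓ (e n)‖ ^ 2 from
    h.symm.trans (inner_self_eq_norm_sq (𝕜 := ℂ) _)]
  positivity

/-- On `Γ` the pairing is orthogonal to every `e n`, so it is zero in `L²(Γ)`; being holomorphic, it
then vanishes on the whole half-plane. -/
lemma kernelPairing_eq_zero {g : Lp ℂ 2 (volume : Measure ℝ)}
    (hg : ∀ n, inner ℂ (lineCauchy hΓ (e n)) g = 0) {w : ℂ} (hw : 0 < w.im) :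
    kernelPairing g w = 0 := by
  have hdiff := differentiableOn_kernelPairing (Lp.memLp g)
  have hmem := Γ.memLp_of_continuousOn (hdiff.continuousOn.mono hΓ)
  refine Γ.eq_zero_of_differentiableOn hΓ hdiff ?_ hw
  have hzero : hmem.toLp = 0 := by
    refine e.repr.injective (lp.ext (funext fun n => ?_))
    rw [e.repr_apply_apply, map_zero]
    have h := hg n
    rw [inner_lineCauchy] at h
    have hpi : (1 / (2 * Real.pi) : ℂ) ≠ 0 := by
      simp
    refine Eq.trans ?_ ((mul_eq_zero.1 h).resolve_left hpi)
    rw [L2.inner_def]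
    refine integral_congr_ae ?_
    filter_upwards [hmem.coeFn_toLp] with τ hτ
    rw [hτ, RCLike.inner_apply']
  filter_upwards [hmem.coeFn_toLp, Lp.coeFn_zero ℂ 2 Γ.arcLength] with τ h1 h2
  rw [← h1, hzero, h2, Pi.zero_apply]

lemma inner_lineCauchy_eq_zero {g : Lp ℂ 2 (volume : Measure ℝ)}
    (hg : ∀ n, inner ℂ (lineCauchy hΓ (e n)) g = 0) (u : Γ.L2) :
    inner ℂ (lineCauchy hΓ u) g = 0 := by
  rw [inner_lineCauchy, integral_eq_zero_of_ae, mul_zero]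
  filter_upwards [Γ.ae_mem_trace] with τ hτ
  rw [kernelPairing_eq_zero hΓ hg (hΓ hτ), mul_zero, Pi.zero_apply]

variable {z : ℂ} (hz : 0 < z.im)

/-- The restriction of `p_z` to the curve. -/
noncomputable def curveKernel : Γ.L2 := (memLp_pKernel_arcLength hΓ hz).toLp

/-- The restriction of `𝒦 u` to the curve. -/
noncomputable def curveCauchy (u : Γ.L2) : Γ.L2 := (memLp_cauchyK hΓ u).toLp

lemma inner_curveKernel (u : Γ.L2) : inner ℂ u (curveKernel hΓ hz) = pCoeff Γ z u := by
  rw [L2.inner_def, pCoeff]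
  refine integral_congr_ae ?_
  filter_upwards [(memLp_pKernel_arcLength hΓ hz).coeFn_toLp] with τ hτ
  rw [curveKernel, hτ, RCLike.inner_apply]

lemma inner_curveCauchy (he : IsEigenbasis Γ e lam) (u : Γ.L2) (n : ℕ) :
    inner ℂ (e n) (curveCauchy hΓ u) = lam n * inner ℂ (e n) u := by
  rw [← inner_eigenfunction_lineCauchy hΓ he, inner_lineCauchy_lineCauchy, L2.inner_def]
  refine integral_congr_ae ?_
  filter_upwards [(memLp_cauchyK hΓ u).coeFn_toLp] with τ hτ
  rw [curveCauchy, hτ, RCLike.inner_apply']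

lemma isSolution_iff_eq {ε : ℝ} {u : Γ.L2} :
    IsSolution Γ z ε u ↔ curveCauchy hΓ u + (ε : ℂ) ^ 2 • u = curveKernel hΓ hz := by
  have h1 := (memLp_cauchyK hΓ u).coeFn_toLp
  have h2 := (memLp_pKernel_arcLength hΓ hz).coeFn_toLp
  have h3 := Lp.coeFn_smul ((ε : ℂ) ^ 2) u
  have h4 := Lp.coeFn_add (curveCauchy hΓ u) ((ε : ℂ) ^ 2 • u)
  rw [Lp.ext_iff, IsSolution]
  refine eventually_congr ?_
  filter_upwards [h1, h2, h3, h4] with τ h1 h2 h3 h4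
  rw [h4, Pi.add_apply, h3, curveCauchy, curveKernel, h1, h2, Pi.smul_apply, smul_eq_mul]

include hΓ hz in
lemma isSolution_iff (he : IsEigenbasis Γ e lam) {ε : ℝ} {u : Γ.L2} :
    IsSolution Γ z ε u ↔
      ∀ n, (lam n + (ε : ℂ) ^ 2) * inner ℂ (e n) u = pCoeff Γ z (e n) := by
  rw [isSolution_iff_eq hΓ hz, ← e.repr.injective.eq_iff, lp.ext_iff, funext_iff]
  refine forall_congr' fun n => ?_
  rw [e.repr_apply_apply, e.repr_apply_apply, inner_add_right, inner_smul_right,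
    inner_curveCauchy hΓ he, inner_curveKernel, add_mul]

include hΓ hz in
lemma existsUnique_isSolution (he : IsEigenbasis Γ e lam) {ε : ℝ} (hε : 0 < ε) :
    ∃! u : Γ.L2, IsSolution Γ z ε u := by
  have hlam := eigenvalue_nonneg hΓ he
  have hne : ∀ n, (lam n + (ε : ℂ) ^ 2) ≠ 0 := fun n => by
    have : lam n + ε ^ 2 ≠ 0 := (add_pos_of_nonneg_of_pos (hlam n) (by positivity)).ne'
    exact_mod_cast this
  -- Since `λ_n ≥ 0`, the denominators are at least `ε²`, so the coefficients of `p_z` dominate.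
  have hmem : Memℓp (fun n => pCoeff Γ z (e n) / (lam n + (ε : ℂ) ^ 2)) 2 := by
    have h := (lp.memℓp (e.repr (curveKernel hΓ hz))).norm.const_mul ((ε ^ 2)⁻¹ : ℝ)
    refine h.mono fun n => ?_
    rw [e.repr_apply_apply, inner_curveKernel, norm_div, div_eq_inv_mul]
    gcongr
    have h2 : ‖(lam n + (ε : ℂ) ^ 2)‖ = lam n + ε ^ 2 := by
      rw [← Complex.ofReal_pow, ← Complex.ofReal_add,
        Complex.norm_of_nonneg (add_nonneg (hlam n) (by positivity))]
    rw [h2]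
    linarith [hlam n]
  refine ⟨e.repr.symm ⟨_, hmem⟩, (isSolution_iff hΓ hz he).2 fun n => ?_, fun v hv => ?_⟩
  · rw [← e.repr_apply_apply, LinearIsometryEquiv.apply_symm_apply]
    exact mul_div_cancel₀ _ (hne n)
  · replace hv := (isSolution_iff hΓ hz he).1 hv
    refine e.repr.injective ?_
    rw [LinearIsometryEquiv.apply_symm_apply]
    refine lp.ext (funext fun n => ?_)
    rw [e.repr_apply_apply]
    exact eq_div_of_mul_eq (hne n) (by rw [mul_comm]; exact hv n)

end Eigen

/-! ### The extended solution and its series. -/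

section Extension

variable {Γ : SimpleC1Curve} (hΓ : Γ.trace ⊆ {ζ | 0 < ζ.im}) {z : ℂ} (hz : 0 < z.im)

include hΓ hz

lemma differentiableAt_extendOff (ε : ℝ) (u : Γ.L2) {ζ : ℂ} (hζ : 0 ≤ ζ.im) :
    DifferentiableAt ℂ (extendOff Γ z ε u) ζ :=
  ((differentiableAt_pKernel hz hζ).sub (differentiableAt_cauchyK hΓ u hζ)).div_const _

lemma exists_norm_extendOff_le (ε : ℝ) (u : Γ.L2) :
    ∃ C : ℝ, ∀ ζ : ℂ, 0 ≤ ζ.im → ‖extendOff Γ z ε u ζ‖ ≤ C * lineWeight ζ.re := by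
  obtain ⟨C, -, hC⟩ := exists_norm_pKernel_le (isCompact_singleton (x := z)) (by simpa using hz)
  obtain ⟨D, -, hD⟩ := exists_norm_cauchyK_le hΓ u
  refine ⟨(C + D) / ‖(ε : ℂ) ^ 2‖, fun ζ hζ => ?_⟩
  rw [extendOff, norm_div, div_mul_eq_mul_div]
  gcongr
  rw [add_mul]
  exact (norm_sub_le _ _).trans (add_le_add (hC z rfl ζ hζ) (hD ζ hζ))

lemma memHardy_extendOff (ε : ℝ) (u : Γ.L2) : MemHardy (extendOff Γ z ε u) := by
  refine ⟨fun ζ hζ => (differentiableAt_extendOff hΓ hz ε u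
    (le_of_lt hζ)).differentiableWithinAt, ?_⟩
  obtain ⟨C, hC⟩ := exists_norm_extendOff_le hΓ hz ε u
  refine lt_of_le_of_lt (iSup₂_le fun y hy => ?_) (memLp_lineWeight.const_mul C).2
  refine eLpNorm_mono fun x => ?_
  have h := hC (x + y * Complex.I) (by simpa using hy.le)
  simp only [Complex.add_re, Complex.ofReal_re, Complex.mul_re, Complex.I_re, mul_zero,
    Complex.ofReal_im, Complex.I_im, sub_zero, add_zero, zero_mul] at h
  exact h.trans (le_abs_self _)

/-- The singularities lie strictly below `ℝ`, so the extension is continuous at every real point. -/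
lemma boundaryValue_extendOff (ε : ℝ) (u : Γ.L2) (x : ℝ) :
    boundaryValue (extendOff Γ z ε u) x = extendOff Γ z ε u x := by
  have hc : ContinuousAt (extendOff Γ z ε u) x :=
    (differentiableAt_extendOff hΓ hz ε u (by simp)).continuousAt
  have hv : Tendsto (fun y : ℝ => (x : ℂ) + y * Complex.I) (𝓝[>] 0) (𝓝 x) := by
    have : Continuous fun y : ℝ => (x : ℂ) + y * Complex.I := by fun_prop
    simpa using (this.tendsto 0).mono_left nhdsWithin_le_nhds
  exact (hc.tendsto.comp hv).limUnder_eq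

/-- The boundary values of the extension, as an element of `L²(ℝ)`. -/
noncomputable def lineExtension (ε : ℝ) (u : Γ.L2) : Lp ℂ 2 (volume : Measure ℝ) :=
  ((ε : ℂ) ^ 2)⁻¹ • (lineKernel hz - lineCauchy hΓ u)

lemma hardyNorm_extendOff (ε : ℝ) (u : Γ.L2) :
    hardyNorm (extendOff Γ z ε u) = ‖lineExtension hΓ hz ε u‖ := by
  rw [hardyNorm, Lp.norm_def]
  congr 1
  refine eLpNorm_congr_ae ?_
  filter_upwards [(memLp_cauchyK_ofReal hΓ u).coeFn_toLp, (memLp_pKernel hz).coeFn_toLp,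
    Lp.coeFn_smul ((ε : ℂ) ^ 2)⁻¹ (lineKernel hz - lineCauchy hΓ u),
    Lp.coeFn_sub (lineKernel hz) (lineCauchy hΓ u)] with x h1 h2 h3 h4
  rw [boundaryValue_extendOff hΓ hz, lineExtension, h3, Pi.smul_apply, h4, Pi.sub_apply,
    lineKernel, lineCauchy, h1, h2, extendOff, smul_eq_mul]
  ring

lemma extendOff_self (ε : ℝ) (u : Γ.L2) :
    extendOff Γ z ε u z =
      1 / (2 * Real.pi) * inner ℂ (lineKernel hz) (lineExtension hΓ hz ε u) := by
  rw [lineExtension, inner_smul_right, inner_sub_right, inner_lineKernel, inner_lineKernel,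
    kernelPairing_lineKernel hz hz, kernelPairing_lineCauchy hΓ u hz, extendOff]
  have : (Real.pi : ℂ) ≠ 0 := by exact_mod_cast Real.pi_ne_zero
  field_simp

lemma inner_lineKernel_eq_zero {e : HilbertBasis ℕ ℂ Γ.L2} {g : Lp ℂ 2 (volume : Measure ℝ)}
    (hg : ∀ n, inner ℂ (lineCauchy hΓ (e n)) g = 0) : inner ℂ (lineKernel hz) g = 0 := by
  rw [inner_lineKernel]
  exact kernelPairing_eq_zero hΓ hg hz

lemma inner_lineExtension_eq_zero {e : HilbertBasis ℕ ℂ Γ.L2} (ε : ℝ) (u : Γ.L2) {g : Lp ℂ 2 (volume : Measure ℝ)}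
    (hg : ∀ n, inner ℂ (lineCauchy hΓ (e n)) g = 0) :
    inner ℂ (lineExtension hΓ hz ε u) g = 0 := by
  rw [lineExtension, inner_smul_left, inner_sub_left, inner_lineCauchy_eq_zero hΓ hg,
    inner_lineKernel_eq_zero hΓ hz hg, sub_zero, mul_zero]

variable {e : HilbertBasis ℕ ℂ Γ.L2} {lam : ℕ → ℝ} (he : IsEigenbasis Γ e lam)
include he

/-- `λ_n = ‖T e_n‖²` and `π_n = (p_z, T e_n)`, so reading `0/0` as `0` loses nothing. -/
lemma pCoeff_eq_zero_of_eigenvalue_eq_zero {n : ℕ} (h : lam n = 0) : pCoeff Γ z (e n) = 0 := by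
  have h0 := inner_lineCauchy_eigenbasis hΓ he n n
  rw [if_pos rfl, h, Complex.ofReal_zero, inner_self_eq_zero] at h0
  rw [← inner_lineCauchy_lineKernel_eq_pCoeff hΓ _ hz, h0, inner_zero_left]

lemma inner_eigenfunction_eq {ε : ℝ} (hε : 0 < ε) {u : Γ.L2} (hu : IsSolution Γ z ε u) (n : ℕ) :
    inner ℂ (e n) u = pCoeff Γ z (e n) / ((lam n + ε ^ 2 : ℝ) : ℂ) := by
  have hpos : 0 < lam n + ε ^ 2 :=
    add_pos_of_nonneg_of_pos (eigenvalue_nonneg hΓ he n) (by positivity)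
  rw [eq_div_iff (by exact_mod_cast hpos.ne'), ← (isSolution_iff hΓ hz he).1 hu n]
  push_cast
  ring

/-- The left side is `ε⁻² (π_n - λ_n (u, e_n))`, which the integral equation collapses to `(u,
e_n)`. -/
lemma inner_lineCauchy_lineExtension {ε : ℝ} (hε : 0 < ε) {u : Γ.L2} (hu : IsSolution Γ z ε u)
    (n : ℕ) : inner ℂ (lineCauchy hΓ (e n)) (lineExtension hΓ hz ε u) = inner ℂ (e n) u := by
  rw [lineExtension, inner_smul_right, inner_sub_right, inner_lineCauchy_lineKernel_eq_pCoeff,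
    inner_eigenfunction_lineCauchy hΓ he, ← (isSolution_iff hΓ hz he).1 hu n]
  have : (ε : ℂ) ≠ 0 := by exact_mod_cast hε.ne'
  field_simp
  ring

/-- This is Parseval for `p_z` on `ℝ`; no asymptotics are needed. -/
lemma summable_sq_pCoeff_div : Summable fun n => ‖pCoeff Γ z (e n)‖ ^ 2 / lam n := by
  have h := (hasSum_inner_mul_inner_div (inner_lineCauchy_eigenbasis hΓ he)
    (fun g hg => inner_lineKernel_eq_zero hΓ hz hg) (lineKernel hz)).summable
  rw [← Complex.summable_ofReal]
  refine h.congr fun n => ?_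
  rw [← inner_conj_symm (lineKernel hz), inner_lineCauchy_lineKernel_eq_pCoeff, ← Complex.normSq_eq_conj_mul_self,
    Complex.normSq_eq_norm_sq]
  push_cast
  rfl

variable {ε : ℝ} (hε : 0 < ε) {u : Γ.L2} (hu : IsSolution Γ z ε u)
include hε hu

lemma hasSum_sq_norm_solution :
    HasSum (fun n => ‖pCoeff Γ z (e n)‖ ^ 2 / (lam n + ε ^ 2) ^ 2) (‖u‖ ^ 2) := by
  have h := Complex.hasSum_re (e.hasSum_inner_mul_inner u u)
  rw [show (inner ℂ u u : ℂ).re = ‖u‖ ^ 2 from inner_self_eq_norm_sq (𝕜 := ℂ) u] at h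
  refine h.congr_fun fun n => ?_
  rw [← inner_conj_symm u, ← Complex.normSq_eq_conj_mul_self, Complex.ofReal_re,
    Complex.normSq_eq_norm_sq, inner_eigenfunction_eq hΓ hz he hε hu, norm_div, div_pow,
    Complex.norm_real, Real.norm_eq_abs, sq_abs]

lemma hasSum_sq_hardyNorm :
    HasSum (fun n => ‖pCoeff Γ z (e n)‖ ^ 2 / (lam n * (lam n + ε ^ 2) ^ 2))
      (hardyNorm (extendOff Γ z ε u) ^ 2) := by
  have h := Complex.hasSum_re (hasSum_inner_mul_inner_div (inner_lineCauchy_eigenbasis hΓ he)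
    (fun g hg => inner_lineExtension_eq_zero hΓ hz ε u hg) (lineExtension hΓ hz ε u))
  rw [show (inner ℂ (lineExtension hΓ hz ε u) (lineExtension hΓ hz ε u) : ℂ).re =
    ‖lineExtension hΓ hz ε u‖ ^ 2 from inner_self_eq_norm_sq (𝕜 := ℂ) _,
    ← hardyNorm_extendOff] at h
  refine h.congr_fun fun n => ?_
  rw [← inner_conj_symm (lineExtension hΓ hz ε u), ← Complex.normSq_eq_conj_mul_self,
    ← Complex.ofReal_div, Complex.ofReal_re, Complex.normSq_eq_norm_sq,
    inner_lineCauchy_lineExtension hΓ hz he hε hu, inner_eigenfunction_eq hΓ hz he hε hu,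
    norm_div, div_pow, Complex.norm_real, Real.norm_eq_abs, sq_abs, div_div, mul_comm (lam n)]

lemma hasSum_extendOff_self :
    HasSum (fun n => ((‖pCoeff Γ z (e n)‖ ^ 2 / (lam n * (lam n + ε ^ 2)) : ℝ) : ℂ))
      (2 * Real.pi * extendOff Γ z ε u z) := by
  have h := hasSum_inner_mul_inner_div (inner_lineCauchy_eigenbasis hΓ he)
    (fun g hg => inner_lineKernel_eq_zero hΓ hz hg) (lineExtension hΓ hz ε u)
  have hpi : (Real.pi : ℂ) ≠ 0 := by exact_mod_cast Real.pi_ne_zero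
  rw [extendOff_self hΓ hz, ← mul_assoc, mul_one_div_cancel (by simp [hpi]), one_mul]
  refine h.congr_fun fun n => ?_
  rw [← inner_conj_symm (lineKernel hz), inner_lineCauchy_lineKernel_eq_pCoeff,
    inner_lineCauchy_lineExtension hΓ hz he hε hu, inner_eigenfunction_eq hΓ hz he hε hu,
    ← mul_div_assoc, ← Complex.normSq_eq_conj_mul_self, Complex.normSq_eq_norm_sq,
    ← Complex.ofReal_div, ← Complex.ofReal_div, div_div, mul_comm (lam n)]

end Extension

/-! ### Two-sided estimates for the series. -/

section Series

lemma exists_forall_le_mul_of_eventually {f g : ℕ → ℝ} (hg : ∀ n, 0 < g n) {A : ℝ}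
    (h : ∀ᶠ n in atTop, f n ≤ A * g n) : ∃ B : ℝ, 1 ≤ B ∧ ∀ n, f n ≤ B * g n := by
  have hb : IsBoundedUnder (· ≤ ·) atTop fun n => f n / g n :=
    ⟨A, (eventually_map.2 <| h.mono fun n hn => (div_le_iff₀ (hg n)).2 hn)⟩
  obtain ⟨B, hB⟩ := hb.bddAbove_range
  refine ⟨max B 1, le_max_right _ _, fun n => ?_⟩
  rw [← div_le_iff₀ (hg n)]
  exact (hB (mem_range_self n)).trans (le_max_left _ _)

lemma eventually_bounds_of_tendsto_div {f g : ℕ → ℝ} (hg : ∀ n, 0 < g n) {C : ℝ} (hC : 0 < C)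
    (h : Tendsto (fun n => f n / (C * g n)) atTop (𝓝 1)) :
    ∀ᶠ n in atTop, C / 2 * g n ≤ f n ∧ f n ≤ 2 * C * g n := by
  filter_upwards [h.eventually (lt_mem_nhds (show (1 / 2 : ℝ) < 1 by norm_num)),
    h.eventually (gt_mem_nhds (show (1 : ℝ) < 2 by norm_num))] with n h1 h2
  have hpos : 0 < C * g n := mul_pos hC (hg n)
  rw [lt_div_iff₀ hpos] at h1
  rw [div_lt_iff₀ hpos] at h2
  constructor <;> linarith

lemma summable_exp_neg_mul_abs_int {d : ℝ} (hd : 0 < d) :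
    Summable fun n : ℤ => Real.exp (-d * |(n : ℝ)|) := by
  have h : Summable fun n : ℕ => Real.exp (-d * n) := by
    simpa only [mul_comm] using Real.summable_exp_nat_mul_iff.2 (neg_lt_zero.2 hd)
  refine Summable.of_nat_of_neg ?_ ?_ <;> simpa using h

/-- The sums `∑ n, exp (-d |n - σ|)` are bounded uniformly in the centre `σ`. -/
lemma exists_bound_of_le_exp_neg_abs {d : ℝ} (hd : 0 < d) :
    ∃ M : ℝ, 0 < M ∧ ∀ (σ K : ℝ) (f : ℕ → ℝ) (S : ℝ), 0 ≤ K →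
      (∀ n, f n ≤ K * Real.exp (-d * |n - σ|)) → HasSum f S → S ≤ K * M := by
  have hs := summable_exp_neg_mul_abs_int hd
  refine ⟨Real.exp d * ∑' n : ℤ, Real.exp (-d * |(n : ℝ)|), ?_, fun σ K f S hK hf hS => ?_⟩
  · exact mul_pos (Real.exp_pos _) (hs.tsum_pos (fun _ => (Real.exp_pos _).le) 0 (Real.exp_pos _))
  -- Rounding the centre to an integer costs a factor `exp d`; the sum over `ℤ` is then translation
  -- invariant.
  · have h1 : HasSum (fun n : ℤ => K * (Real.exp d * Real.exp (-d * |((n - ⌊σ⌋ : ℤ) : ℝ)|)))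
        (K * (Real.exp d * ∑' n : ℤ, Real.exp (-d * |(n : ℝ)|))) :=
      (((Equiv.subRight ⌊σ⌋).hasSum_iff
        (f := fun n : ℤ => Real.exp (-d * |(n : ℝ)|))).2 hs.hasSum).mul_left _ |>.mul_left _
    refine hasSum_le_inj (fun n : ℕ => (n : ℤ)) Nat.cast_injective (fun _ _ => by positivity)
      (fun n => (hf n).trans ?_) hS h1
    rw [← Real.exp_add]
    gcongr
    have h2 : |((n : ℤ) - ⌊σ⌋ : ℝ)| ≤ |(n : ℝ) - σ| + 1 := by
      have h3 := abs_sub_le (n : ℝ) σ ⌊σ⌋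
      have h4 : |σ - ⌊σ⌋| ≤ 1 := by
        rw [abs_of_nonneg (sub_nonneg.2 (Int.floor_le σ))]
        linarith [Int.lt_floor_add_one σ]
      push_cast
      linarith
    push_cast at h2 ⊢
    nlinarith

variable {lam w : ℕ → ℝ} {C₁ C₂ α β : ℝ}

/-- Past the crossover `λ_n ≈ s` the terms decay at rate `β - jα`; before it they grow at rate `(j +
k)α - β`. Both rates are positive, so the sum is controlled by its peak size `s^(β/α - j - k)`. -/
lemma exists_le_of_hasSum (hlam0 : ∀ n, 0 ≤ lam n)
    (hz : ∀ n, lam n = 0 → w n = 0) (hC₁ : 0 < C₁) (hC₂ : 0 < C₂) (hα : 0 < α)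
    (hlam : Tendsto (fun n : ℕ => lam n / (C₁ * Real.exp (-α * (n + 1)))) atTop (𝓝 1))
    (hw : Tendsto (fun n : ℕ => w n / (C₂ * Real.exp (-β * (n + 1)))) atTop (𝓝 1))
    (j k : ℕ) (hj : j * α < β) (hjk : β < (j + k) * α) :
    ∃ C : ℝ, 0 < C ∧ ∀ s S : ℝ, 0 < s →
      HasSum (fun n => w n / (lam n ^ j * (lam n + s) ^ k)) S → S ≤ C * s ^ (β / α - (j + k)) := by
  obtain ⟨A, hA1, hA⟩ := exists_forall_le_mul_of_eventually (fun n : ℕ => Real.exp_pos (-β * (n + 1)))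
    ((eventually_bounds_of_tendsto_div (fun n : ℕ => Real.exp_pos (-β * (n + 1))) hC₂ hw).mono
      fun n hn => hn.2)
  obtain ⟨B, hB1, hB⟩ := exists_forall_le_mul_of_eventually (f := fun n => (lam n)⁻¹)
    (g := fun n : ℕ => Real.exp (α * (n + 1))) (A := (C₁ / 2)⁻¹) (fun n : ℕ => Real.exp_pos _)
    ((eventually_bounds_of_tendsto_div (fun n : ℕ => Real.exp_pos (-α * (n + 1))) hC₁ hlam).mono
      fun n hn => by
        have h := inv_anti₀ (by positivity) hn.1
        rwa [mul_inv, ← Real.exp_neg, ← neg_mul, neg_neg] at h)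
  set d := min (β - j * α) ((j + k) * α - β) with hd
  have hdpos : 0 < d := lt_min (by linarith) (by linarith)
  obtain ⟨M, hM, hbound⟩ := exists_bound_of_le_exp_neg_abs hdpos
  refine ⟨A * B ^ (j + k) * M, by positivity, fun s S hs hS => ?_⟩
  -- The centre `σ` solves `exp (-α (σ + 1)) = s`; the `-1` reflects indexing from `0`.
  have hmain := hbound (-1 - Real.log s / α) (A * B ^ (j + k) * s ^ (β / α - (j + k))) _ S
    (by positivity) (fun n => ?_) hS
  · linarith
  have hspow : s ^ (β / α - (j + k)) = Real.exp (Real.log s * (β / α - (j + k))) :=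
    Real.rpow_def_of_pos hs _
  have hsk : (s ^ k)⁻¹ = Real.exp (-(k * Real.log s)) := by
    rw [Real.exp_neg, Real.exp_nat_mul, Real.exp_log hs]
  have hBpow (m : ℕ) : (Real.exp (α * (n + 1))) ^ m = Real.exp (m * (α * (n + 1))) :=
    (Real.exp_nat_mul _ _).symm
  rcases eq_or_ne (lam n) 0 with h0 | h0
  · rw [hz n h0, zero_div]
    positivity
  have hl : 0 < lam n := (hlam0 n).lt_of_ne' h0
  have hA' := hA n
  have hB' := hB n
  have hl' : (lam n)⁻¹ ≤ B * Real.exp (α * (n + 1)) := hB'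
  set τ : ℝ := n - (-1 - Real.log s / α) with hτ
  have hlog : Real.log s = α * (τ - (n + 1)) := by rw [hτ]; field_simp; ring
  -- Past the crossover bound `λ_n + s` below by `s`; before it, by `λ_n`.
  rcases le_total 0 τ with hτ0 | hτ0
  · have h1 : w n / (lam n ^ j * (lam n + s) ^ k) ≤
        (A * Real.exp (-β * (n + 1))) * ((B * Real.exp (α * (n + 1))) ^ j * (s ^ k)⁻¹) := by
      rw [div_eq_mul_inv, mul_inv, ← inv_pow]
      gcongr
      · linarith
    refine h1.trans ?_
    have h2 : B ^ j ≤ B ^ (j + k) := pow_le_pow_right₀ hB1 (Nat.le_add_right _ _)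
    rw [mul_pow, hBpow, hsk, hspow, abs_of_nonneg hτ0]
    calc _ = (A * B ^ j) * Real.exp (-β * (n + 1) + j * (α * (n + 1)) + -(k * Real.log s)) := by
          rw [Real.exp_add, Real.exp_add]; ring
      _ ≤ (A * B ^ (j + k)) * Real.exp (Real.log s * (β / α - (j + k)) + -d * τ) := by
          refine mul_le_mul (mul_le_mul_of_nonneg_left h2 (by positivity))
            (Real.exp_le_exp.2 ?_) (by positivity) (by positivity)
          have h3 : d * τ ≤ (β - j * α) * τ := by
            gcongr
            exact min_le_left _ _
          have h4 : Real.log s * (β / α - (j + k)) = (τ - (n + 1)) * (β - (j + k) * α) := by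
            rw [hlog]; field_simp
          rw [h4, hlog]
          nlinarith
      _ = _ := by rw [Real.exp_add]; ring
  · have h1 : w n / (lam n ^ j * (lam n + s) ^ k) ≤
        (A * Real.exp (-β * (n + 1))) * (B * Real.exp (α * (n + 1))) ^ (j + k) := by
      rw [div_eq_mul_inv, mul_inv, ← inv_pow, ← inv_pow, pow_add]
      have h2 : (lam n + s)⁻¹ ≤ B * Real.exp (α * (n + 1)) :=
        (inv_anti₀ hl (by linarith)).trans hl'
      gcongr
    refine h1.trans ?_
    rw [mul_pow, hBpow, hspow, abs_of_nonpos hτ0]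
    calc _ = (A * B ^ (j + k)) * Real.exp (-β * (n + 1) + (j + k : ℕ) * (α * (n + 1))) := by
          rw [Real.exp_add]; ring
      _ ≤ (A * B ^ (j + k)) * Real.exp (Real.log s * (β / α - (j + k)) + -d * -τ) := by
          refine mul_le_mul_of_nonneg_left (Real.exp_le_exp.2 ?_) (by positivity)
          have h3 : d * -τ ≤ ((j + k) * α - β) * -τ := by
            have : 0 ≤ -τ := by linarith
            gcongr
            exact min_le_right _ _
          have h4 : Real.log s * (β / α - (j + k)) = (τ - (n + 1)) * (β - (j + k) * α) := by
            rw [hlog]; field_simp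
          rw [h4]
          push_cast
          nlinarith
      _ = _ := by rw [Real.exp_add]; ring

/-- A single term suffices: one at bounded distance past the crossover already has the peak size. -/
lemma exists_ge_of_hasSum (hlam0 : ∀ n, 0 ≤ lam n) (hw0 : ∀ n, 0 ≤ w n)
    (hC₁ : 0 < C₁) (hC₂ : 0 < C₂) (hα : 0 < α) (hβ : 0 < β)
    (hlam : Tendsto (fun n : ℕ => lam n / (C₁ * Real.exp (-α * (n + 1)))) atTop (𝓝 1))
    (hw : Tendsto (fun n : ℕ => w n / (C₂ * Real.exp (-β * (n + 1)))) atTop (𝓝 1))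
    (j k : ℕ) (s₀ : ℝ) :
    ∃ c : ℝ, 0 < c ∧ ∀ s S : ℝ, 0 < s → s ≤ s₀ →
      HasSum (fun n => w n / (lam n ^ j * (lam n + s) ^ k)) S → c * s ^ (β / α - (j + k)) ≤ S := by
  obtain ⟨N, hN⟩ := eventually_atTop.1
    ((eventually_bounds_of_tendsto_div (fun n : ℕ => Real.exp_pos (-α * (n + 1))) hC₁ hlam).and
    (eventually_bounds_of_tendsto_div (fun n : ℕ => Real.exp_pos (-β * (n + 1))) hC₂ hw))
  -- A bound for `n - σ`: `N` for the asymptotics to hold, `1` for rounding up, and the maximum for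
  -- a negative centre `σ`, where `s ≤ s₀` enters.
  set κ : ℝ := N + 1 + max 0 (1 + Real.log s₀ / α) with hκ
  refine ⟨C₂ / 2 * Real.exp (-β * κ) / ((2 * C₁) ^ j * (2 * C₁ + 1) ^ k), by positivity,
    fun s S hs hs0 hS => ?_⟩
  set σ : ℝ := -1 - Real.log s / α with hσ
  set n : ℕ := N + ⌈σ⌉₊ with hn
  have hnσ : σ ≤ n := by
    rw [hn]; push_cast
    linarith [Nat.le_ceil σ, (Nat.cast_nonneg N : (0 : ℝ) ≤ N)]
  have hnκ : n - σ ≤ κ := by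
    have h1 : (⌈σ⌉₊ : ℝ) ≤ max σ 0 + 1 := by
      rcases le_total 0 σ with h | h
      · rw [max_eq_left h]; exact (Nat.ceil_lt_add_one h).le
      · rw [Nat.ceil_eq_zero.2 h, max_eq_right h]; norm_num
    have h2 : max σ 0 - σ ≤ max 0 (1 + Real.log s₀ / α) := by
      have h3 : Real.log s / α ≤ Real.log s₀ / α := by gcongr
      rcases le_total 0 σ with h | h
      · rw [max_eq_left h, sub_self]; exact le_max_left _ _
      · rw [max_eq_right h]; exact le_trans (by rw [hσ]; linarith) (le_max_right _ _)
    rw [hn, hκ]; push_cast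
    linarith
  obtain ⟨⟨hlow, hl⟩, hwn, -⟩ := hN n (by rw [hn]; exact Nat.le_add_right _ _)
  have hlog : Real.log s = -α * (σ + 1) := by rw [hσ]; field_simp; ring
  have hxs : Real.exp (-α * (n + 1)) ≤ s := by
    rw [← Real.le_log_iff_exp_le hs, hlog]
    nlinarith
  have hterm := le_hasSum hS n fun m _ => by
    have := hlam0 m
    have := hw0 m
    positivity
  refine le_trans ?_ hterm
  have hs_pow : s ^ (β / α - (j + k)) = Real.exp (-β * (σ + 1)) / (s ^ j * s ^ k) := by
    rw [Real.rpow_sub hs, Real.rpow_add hs, Real.rpow_natCast, Real.rpow_natCast]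
    congr 1
    rw [Real.rpow_def_of_pos hs, hlog]
    congr 1
    field_simp
  have hlpos : 0 < lam n := lt_of_lt_of_le (by positivity) hlow
  have hden : lam n ^ j * (lam n + s) ^ k ≤ (2 * C₁ * s) ^ j * ((2 * C₁ + 1) * s) ^ k := by
    have h1 : lam n ≤ 2 * C₁ * s := hl.trans (by gcongr)
    gcongr
    linarith
  have hnum : C₂ / 2 * (Real.exp (-β * κ) * Real.exp (-β * (σ + 1))) ≤ w n := by
    refine le_trans ?_ hwn
    rw [← Real.exp_add]
    gcongr
    nlinarith
  calc C₂ / 2 * Real.exp (-β * κ) / ((2 * C₁) ^ j * (2 * C₁ + 1) ^ k) * s ^ (β / α - (j + k))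
      = C₂ / 2 * (Real.exp (-β * κ) * Real.exp (-β * (σ + 1))) /
          ((2 * C₁ * s) ^ j * ((2 * C₁ + 1) * s) ^ k) := by
        rw [hs_pow, mul_pow _ s, mul_pow _ s]
        field_simp
    _ ≤ _ := div_le_div₀ (hw0 n) hnum (by positivity) hden

/-- The terms are of order `exp ((2α - β) n)`, so they do not tend to zero. -/
lemma not_summable_div_sq (hC₁ : 0 < C₁) (hC₂ : 0 < C₂) (hβα : β < 2 * α)
    (hlam : Tendsto (fun n : ℕ => lam n / (C₁ * Real.exp (-α * (n + 1)))) atTop (𝓝 1))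
    (hw : Tendsto (fun n : ℕ => w n / (C₂ * Real.exp (-β * (n + 1)))) atTop (𝓝 1)) :
    ¬ Summable fun n => w n / lam n ^ 2 := by
  intro h
  have h0 := h.tendsto_atTop_zero
  set a : ℝ := C₂ / 2 / (2 * C₁) ^ 2 with ha
  have hapos : 0 < a := by positivity
  have hge : ∀ᶠ n in atTop, a ≤ w n / lam n ^ 2 := by
    filter_upwards [eventually_bounds_of_tendsto_div
        (fun n : ℕ => Real.exp_pos (-α * (n + 1))) hC₁ hlam,
      eventually_bounds_of_tendsto_div (fun n : ℕ => Real.exp_pos (-β * (n + 1))) hC₂ hw]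
      with n h1 h2
    have hl : 0 < lam n := lt_of_lt_of_le (by positivity) h1.1
    rw [le_div_iff₀ (by positivity)]
    calc a * lam n ^ 2 ≤ a * (2 * C₁ * Real.exp (-α * (n + 1))) ^ 2 := by gcongr; exact h1.2
      _ = C₂ / 2 * Real.exp (2 * (-α * (n + 1))) := by
          rw [ha, mul_pow (2 * C₁) (Real.exp _), ← Real.exp_nat_mul]; push_cast; field_simp
      _ ≤ C₂ / 2 * Real.exp (-β * (n + 1)) := by
          refine mul_le_mul_of_nonneg_left (Real.exp_le_exp.2 ?_) (by positivity)
          have : (0 : ℝ) ≤ n + 1 := by positivity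
          nlinarith
      _ ≤ w n := h2.1
  obtain ⟨n, hn1, hn2⟩ := (hge.and (h0.eventually (gt_mem_nhds hapos))).exists
  linarith

end Series

/-! ### Assembling the estimates. -/

lemma mul_min_bounds {ε t p h v a₁ A₁ a₂ A₂ a₃ A₃ : ℝ} (hε : 0 < ε) (ht : 0 < t)
    (ha₁ : 0 < a₁) (ha₂ : 0 < a₂) (ha₃ : 0 < a₃)
    (hp : a₁ * t ≤ p ∧ p ≤ A₁ * t) (hh : a₂ * t ≤ ε * h ∧ ε * h ≤ A₂ * t)
    (hv : a₃ * t ^ 2 ≤ v ∧ v ≤ A₃ * t ^ 2) :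
    (a₁ / A₂ * (ε * h) ≤ p ∧ p ≤ A₁ / a₂ * (ε * h)) ∧
      a₃ / max A₁ A₂ * (ε * t) ≤ v * min (1 / h) (ε / p) ∧
      v * min (1 / h) (ε / p) ≤ A₃ / a₁ * (ε * t) := by
  have hp0 : 0 < p := lt_of_lt_of_le (by positivity) hp.1
  have hεh : 0 < ε * h := lt_of_lt_of_le (by positivity) hh.1
  have hh0 : 0 < h := (pos_iff_pos_of_mul_pos hεh).1 hε
  have hA₁ : 0 < A₁ := (pos_iff_pos_of_mul_pos (hp0.trans_le hp.2)).2 ht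
  have hA₂ : 0 < A₂ := (pos_iff_pos_of_mul_pos (hεh.trans_le hh.2)).2 ht
  have hv0 : 0 < v := lt_of_lt_of_le (by positivity) hv.1
  have hm : 0 < max A₁ A₂ := lt_max_of_lt_left hA₁
  refine ⟨⟨?_, ?_⟩, ?_, ?_⟩
  · rw [div_mul_eq_mul_div, div_le_iff₀ hA₂]
    calc a₁ * (ε * h) ≤ a₁ * (A₂ * t) := mul_le_mul_of_nonneg_left hh.2 ha₁.le
      _ = a₁ * t * A₂ := by ring
      _ ≤ p * A₂ := by gcongr; exact hp.1
  · rw [div_mul_eq_mul_div, le_div_iff₀ ha₂]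
    calc p * a₂ ≤ A₁ * t * a₂ := by gcongr; exact hp.2
      _ = A₁ * (a₂ * t) := by ring
      _ ≤ A₁ * (ε * h) := mul_le_mul_of_nonneg_left hh.1 hA₁.le
  · have hmin : ε / (max A₁ A₂ * t) ≤ min (1 / h) (ε / p) := by
      refine le_min ?_ ?_
      · rw [div_le_div_iff₀ (by positivity) hh0, one_mul]
        exact hh.2.trans (by gcongr; exact le_max_right _ _)
      · gcongr
        exact hp.2.trans (by gcongr; exact le_max_left _ _)
    calc a₃ / max A₁ A₂ * (ε * t) = a₃ * t ^ 2 * (ε / (max A₁ A₂ * t)) := by field_simp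
      _ ≤ v * min (1 / h) (ε / p) := by gcongr; exact hv.1
  · have hmin : min (1 / h) (ε / p) ≤ ε / (a₁ * t) :=
      (min_le_right _ _).trans (by gcongr; exact hp.1)
    calc v * min (1 / h) (ε / p) ≤ A₃ * t ^ 2 * (ε / (a₁ * t)) := by
          have := hv0.le.trans hv.2
          gcongr
          exact hv.2
      _ = A₃ / a₁ * (ε * t) := by field_simp

lemma sqrt_mul_le_of_sq_bounds {c C t p : ℝ} (hc : 0 < c) (hC : 0 < C) (ht : 0 < t) (hp : 0 ≤ p)
    (h1 : c * t ^ 2 ≤ p ^ 2) (h2 : p ^ 2 ≤ C * t ^ 2) : √c * t ≤ p ∧ p ≤ √C * t := by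
  constructor
  · refine le_of_sq_le_sq ?_ hp
    rwa [mul_pow, Real.sq_sqrt hc.le]
  · refine le_of_sq_le_sq ?_ (by positivity)
    rwa [mul_pow, Real.sq_sqrt hC.le]

/-- Sequences are indexed from `0`, so `e n`, `lam n` are the `(n + 1)`-st eigenfunction and
eigenvalue. -/
theorem theorem2p4 (Γ : SimpleC1Curve) (hΓ : Γ.trace ⊆ {ζ | 0 < ζ.im})
    (z : ℂ) (hz : 0 < z.im) (hzΓ : z ∉ Γ.trace)
    (e : HilbertBasis ℕ ℂ Γ.L2) (lam : ℕ → ℝ) (he : IsEigenbasis Γ e lam)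
    (C₁ C₂ α β : ℝ) (hC₁ : 0 < C₁) (hC₂ : 0 < C₂)
    (hα : 0 < α) (hαβ : α < β) (hβα : β < 2 * α)
    (hlam : Tendsto (fun n : ℕ => lam n / (C₁ * Real.exp (-α * (n + 1)))) atTop (𝓝 1))
    (hpi : Tendsto (fun n : ℕ => ‖pCoeff Γ z (e n)‖ ^ 2 / (C₂ * Real.exp (-β * (n + 1))))
      atTop (𝓝 1)) :
    (Summable (fun n => ‖pCoeff Γ z (e n)‖ ^ 2 / lam n) ∧
      ¬ Summable (fun n => ‖pCoeff Γ z (e n)‖ ^ 2 / lam n ^ 2)) ∧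
    (∀ ε : ℝ, 0 < ε → ∃! u : Γ.L2, IsSolution Γ z ε u) ∧
    ∀ ε₀ : ℝ, 0 < ε₀ → ∃ c C : ℝ, 0 < c ∧ 0 < C ∧
      ∀ ε : ℝ, 0 < ε → ε ≤ ε₀ → ∀ u : Γ.L2, IsSolution Γ z ε u →
        MemHardy (extendOff Γ z ε u) ∧
        (c * (ε * hardyNorm (extendOff Γ z ε u)) ≤ ‖u‖ ∧
          ‖u‖ ≤ C * (ε * hardyNorm (extendOff Γ z ε u))) ∧
        ((maximizer Γ z ε u z).im = 0 ∧
          c * ε ^ ((β - α) / α) ≤ (maximizer Γ z ε u z).re ∧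
          (maximizer Γ z ε u z).re ≤ C * ε ^ ((β - α) / α)) := by
  refine ⟨⟨summable_sq_pCoeff_div hΓ hz he, not_summable_div_sq hC₁ hC₂ hβα hlam hpi⟩,
    fun ε hε => existsUnique_isSolution hΓ hz he hε, fun ε₀ hε₀ => ?_⟩
  have hlam0 := eigenvalue_nonneg hΓ he
  have hw0 : ∀ n, 0 ≤ ‖pCoeff Γ z (e n)‖ ^ 2 := fun n => by positivity
  have hzero : ∀ n, lam n = 0 → ‖pCoeff Γ z (e n)‖ ^ 2 = 0 := fun n hn => by
    rw [pCoeff_eq_zero_of_eigenvalue_eq_zero hΓ hz he hn, norm_zero, zero_pow two_ne_zero]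
  have hβ : 0 < β := hα.trans hαβ
  have hup (j k : ℕ) := exists_le_of_hasSum hlam0 hzero hC₁ hC₂ hα hlam hpi j k
  have hlo (j k : ℕ) := exists_ge_of_hasSum hlam0 hw0 hC₁ hC₂ hα hβ hlam hpi j k (ε₀ ^ 2)
  -- The exponents `(j, k) = (0, 2), (1, 2), (1, 1)` belong to `‖u‖²`, `‖u‖²_{H²}` and `2π u(z)`.
  obtain ⟨A₁, hA₁, hA₁'⟩ := hup 0 2 (by simpa using hβ) (by push_cast; linarith)
  obtain ⟨A₂, hA₂, hA₂'⟩ := hup 1 2 (by simpa using hαβ) (by push_cast; linarith)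
  obtain ⟨A₃, hA₃, hA₃'⟩ := hup 1 1 (by simpa using hαβ) (by push_cast; linarith)
  obtain ⟨a₁, ha₁, ha₁'⟩ := hlo 0 2
  obtain ⟨a₂, ha₂, ha₂'⟩ := hlo 1 2
  obtain ⟨a₃, ha₃, ha₃'⟩ := hlo 1 1
  have hpi0 := Real.pi_pos
  have hmax : 0 < max √A₁ √A₂ := lt_max_of_lt_left (Real.sqrt_pos.2 hA₁)
  refine ⟨min (√a₁ / √A₂) (a₃ / (2 * Real.pi) / max √A₁ √A₂),
    max (√A₁ / √a₂) (A₃ / (2 * Real.pi) / √a₁), lt_min (by positivity) (by positivity),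
    lt_max_of_lt_left (by positivity), fun ε hε hεε₀ u hu => ?_⟩
  refine ⟨memHardy_extendOff hΓ hz ε u, ?_⟩
  have hs : 0 < ε ^ 2 := by positivity
  have hs0 : ε ^ 2 ≤ ε₀ ^ 2 := by gcongr
  -- The common scale of `‖u‖` and `ε ‖u‖_{H²}`.
  set t : ℝ := ε ^ (β / α - 2) with ht
  have htpos : 0 < t := Real.rpow_pos_of_pos hε _
  have hpow₂ : (ε ^ 2) ^ (β / α - 2) = t ^ 2 := by
    rw [ht, ← Real.rpow_natCast, ← Real.rpow_natCast, ← Real.rpow_mul hε.le,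
      ← Real.rpow_mul hε.le, mul_comm]
  have hpow₃ : (ε ^ 2) ^ (β / α - 3) = (t / ε) ^ 2 := by
    rw [show β / α - 3 = β / α - 2 - 1 by ring, Real.rpow_sub hs, hpow₂, Real.rpow_one, div_pow]
  have hsol := hasSum_sq_norm_solution hΓ hz he hε hu
  have hhardy := hasSum_sq_hardyNorm hΓ hz he hε hu
  have hval := hasSum_extendOff_self hΓ hz he hε hu
  have hre := Complex.hasSum_re hval
  have him := Complex.hasSum_im hval
  simp only [Complex.ofReal_re, Complex.ofReal_im] at hre him
  have hnn : 0 ≤ hardyNorm (extendOff Γ z ε u) := ENNReal.toReal_nonneg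
  have e₀ : β / α - ((0 : ℕ) + (2 : ℕ)) = β / α - 2 := by norm_num
  have e₁ : β / α - ((1 : ℕ) + (2 : ℕ)) = β / α - 3 := by norm_num
  have e₂ : β / α - ((1 : ℕ) + (1 : ℕ)) = β / α - 2 := by norm_num
  have hp := sqrt_mul_le_of_sq_bounds ha₁ hA₁ htpos (norm_nonneg u)
    (by simpa only [e₀, hpow₂] using ha₁' _ _ hs hs0 (by simpa using hsol))
    (by simpa only [e₀, hpow₂] using hA₁' _ _ hs (by simpa using hsol))
  have hh := sqrt_mul_le_of_sq_bounds ha₂ hA₂ (div_pos htpos hε) hnn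
    (by simpa only [e₁, hpow₃] using ha₂' _ _ hs hs0 (by simpa using hhardy))
    (by simpa only [e₁, hpow₃] using hA₂' _ _ hs (by simpa using hhardy))
  have hh' : √a₂ * t ≤ ε * hardyNorm (extendOff Γ z ε u) ∧
      ε * hardyNorm (extendOff Γ z ε u) ≤ √A₂ * t := by
    rw [← mul_div_assoc, ← mul_div_assoc, div_le_iff₀ hε, le_div_iff₀ hε] at hh
    rwa [mul_comm ε]
  have hcast : (2 * Real.pi * extendOff Γ z ε u z : ℂ) =
      ((2 * Real.pi : ℝ) : ℂ) * extendOff Γ z ε u z := by push_cast; ring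
  rw [hcast, Complex.re_ofReal_mul] at hre
  rw [hcast, Complex.im_ofReal_mul] at him
  have him0 : (extendOff Γ z ε u z).im = 0 := by
    have := him.unique hasSum_zero
    exact (mul_eq_zero.1 this).resolve_left (by positivity)
  have hv₁ : a₃ * t ^ 2 ≤ 2 * Real.pi * (extendOff Γ z ε u z).re := by
    simpa only [e₂, hpow₂] using ha₃' _ _ hs hs0 (by simpa using hre)
  have hv₂ : 2 * Real.pi * (extendOff Γ z ε u z).re ≤ A₃ * t ^ 2 := by
    simpa only [e₂, hpow₂] using hA₃' _ _ hs (by simpa using hre)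
  have hv : a₃ / (2 * Real.pi) * t ^ 2 ≤ (extendOff Γ z ε u z).re ∧
      (extendOff Γ z ε u z).re ≤ A₃ / (2 * Real.pi) * t ^ 2 := by
    rw [div_mul_eq_mul_div, div_mul_eq_mul_div, div_le_iff₀ (by positivity),
      le_div_iff₀ (by positivity), mul_comm _ (2 * Real.pi)]
    exact ⟨hv₁, hv₂⟩
  obtain ⟨⟨h1, h2⟩, h3, h4⟩ := mul_min_bounds hε htpos (Real.sqrt_pos.2 ha₁) (Real.sqrt_pos.2 ha₂)
    (by positivity) hp hh' hv
  have hεt : ε * t = ε ^ ((β - α) / α) := by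
    rw [ht, show (β - α) / α = 1 + (β / α - 2) by field_simp; ring, Real.rpow_add hε, Real.rpow_one]
  rw [hεt] at h3 h4
  have hεγ : 0 < ε ^ ((β - α) / α) := Real.rpow_pos_of_pos hε _
  refine ⟨⟨le_trans ?_ h1, h2.trans ?_⟩, ?_, ?_, ?_⟩
  · gcongr
    exact min_le_left _ _
  · gcongr
    exact le_max_left _ _
  · rw [maximizer, Complex.im_mul_ofReal, him0, zero_mul]
  · rw [maximizer, Complex.re_mul_ofReal]
    refine le_trans ?_ h3
    gcongr
    exact min_le_right _ _
  · rw [maximizer, Complex.re_mul_ofReal]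
    refine h4.trans ?_
    gcongr
    exact le_max_right _ _
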